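/- **Theorem.** A *surface ribbon* is a compact surface with boundary embedded in 3-space, presented by a plane diagram: the flat plane thickening (by ribbons, without half-twists) of a trivalent graph with over/under crossings, circle components and disk components being allowed. Surface ribbons are taken up to isotopy, i.e. diagrams are considered up to isotopy of the plane and the moves RII, RIII, CL (two successive small loops with opposite crossings cancel), YI and IY (a ribbon slides over or under a trivalent vertex) and IH (the move on trivalent graphs exchanging the two ways of resolving a $4$-valent vertex). For a diagram $D$, the *fundamental heap* $h(D)$ is (the group heap, $(x,y,z)\mapsto xy^{-1}z$, of) the group with one generator for each arc of the boundary curves of the ribbons, so that every ribbon segment carries two generators, and with two relations for each crossing: if the over-ribbon has boundary arcs $u,v$, and an arc $x$ passes under it, first under $u$ and then under $v$, and continues as the arc $z$, then $z=xu^{-1}v$. Trivalent vertices impose no relation, boundary arcs running through a vertex keeping their label, and each disk component contributes one free generator. For a surface ribbon $S$ and a group $H$, we write $h(S)\cong H$ if $h(D)\cong H$ for every diagram $D$ of $S$. Let $F_k$ denote the free group of rank $k$. Let $G$ be a finitely presented group. Then there exist a surface ribbon $S$ and a positive integer $k$ such that $h(S)\cong F_k*G$. Moreover, if $G\cong\langle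 \alpha_1,\dots,\alpha_n\mid R_1,\dots,R_m\rangle$ with $n,m\ge 0$, then there exists a surface ribbon $S$ such that $h(S)\cong F_{n+m+1}*G$. -/

import Mathlib

/-!
A surface ribbon is a compact surface with boundary in 3-space, presented by a flat plane diagram:
the plane thickening of a trivalent graph with over/under crossings.  A diagram in general position
with respect to the height function is a stack of elementary slices.  Each slice contains exactly
one elementary event (a minimum, a maximum, a crossing, or a trivalent vertex); all other ribbons
run straight up.  The ribbons at each level are numbered `0, 1, 2, …` from left to right.
-/

namespace SurfaceRibbons

/-- The elementary events, read from bottom to top. -/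
inductive Event : Type
  /-- a local minimum: two new adjacent ribbons appear -/
  | cup
  /-- a local maximum: two adjacent ribbons are joined -/
  | cap
  /-- a crossing of two adjacent ribbons; for `true`, the ribbon from bottom left to top right is
  the over-ribbon, for `false` it is the under-ribbon -/
  | cross (leftOver : Bool)
  /-- a trivalent vertex with one ribbon below and two above -/
  | split
  /-- a trivalent vertex with two ribbons below and one above -/
  | merge

/-- Number of ribbons at the bottom of an event. -/
def Event.dom : Event → ℕ
  | .cup => 0
  | .cap => 2
  | .cross _ => 2
  | .split => 1
  | .merge => 2

/-- Number of ribbons at the top of an event. -/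
def Event.cod : Event → ℕ
  | .cup => 2
  | .cap => 0
  | .cross _ => 2
  | .split => 2
  | .merge => 1

/-- A slice: one event, with exactly `pos` ribbons to the left of it. -/
structure Slice : Type where
  event : Event
  pos : ℕ

/-- The number of ribbons above a slice that has `n` ribbons below it. -/
def Slice.next (n : ℕ) (s : Slice) : ℕ := n - s.event.dom + s.event.cod

/-- A stack of slices (listed from bottom to top) fits together, starting with `n` ribbons at the
bottom and ending with no ribbons at the top. -/
def Fits : ℕ → List Slice → Prop
  | n, [] => n = 0
  | n, s :: w => s.pos + s.event.dom ≤ n ∧ Fits (s.next n) w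

/-- A diagram of a surface ribbon: a closed stack of slices (a plane diagram of a thickened flat
trivalent graph, possibly with circle components), together with a number of disk components.
Disks have no trivalent spine; they can be shrunk and moved away from everything else, so only
their number matters. -/
structure Diagram : Type where
  word : List Slice
  fits : Fits 0 word
  disks : ℕ

/-! ### The fundamental heap of a diagram -/

/-- The two boundary arcs of a ribbon, seen with the ribbon running upwards. -/
inductive Side : Type
  | left
  | right

namespace Diagram

/-- The number of ribbons at level `t`, that is, above the first `t` slices. -/
def width (D : Diagram) (t : ℕ) : ℕ := (D.word.take t).foldl Slice.next 0

/-- The pieces in which the levels cut the boundary arcs of the ribbons of the diagram. -/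
structure Piece (D : Diagram) : Type where
  level : ℕ
  pos : ℕ
  side : Side
  level_le : level ≤ D.word.length
  pos_lt : pos < D.width level

/-- Generators: the pieces of the boundary arcs, and one generator for each disk. -/
abbrev Gen (D : Diagram) : Type := D.Piece ⊕ Fin D.disks

open Classical in
/-- The generator of the piece at level `t`, position `j` and side `σ`
(`1` by convention if there is no such piece). -/
noncomputable def arc (D : Diagram) (t j : ℕ) (σ : Side) : FreeGroup D.Gen :=
  if h : t ≤ D.word.length ∧ j < D.width t then
    FreeGroup.of (Sum.inl ⟨t, j, σ, h.1, h.2⟩)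
  else 1

end Diagram

/-- The equations `p = q` imposed by a slice with `n` ribbons below it, when the arcs at the bottom
of the slice carry the labels `a j σ`, and those at the top the labels `b j σ`.
An arc keeps its label except when it passes under a ribbon: an arc labelled `x` that passes
under a ribbon, first under the boundary arc `u` and then under the boundary arc `v`,
continues with the label `x * u⁻¹ * v`. -/
inductive Slice.Equation {H : Type*} [Group H] (n : ℕ) (a b : ℕ → Side → H) :
    Slice → H → H → Prop
  | left_of (e : Event) (i j : ℕ) (σ : Side) (h : j < i) :
      Equation n a b ⟨e, i⟩ (b j σ) (a j σ)
  | right_of (e : Event) (i d : ℕ) (σ : Side) (h : i + e.dom + d < n) :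
      Equation n a b ⟨e, i⟩ (b (i + e.cod + d) σ) (a (i + e.dom + d) σ)
  | cup_outer (i : ℕ) : Equation n a b ⟨.cup, i⟩ (b i .left) (b (i + 1) .right)
  | cup_inner (i : ℕ) : Equation n a b ⟨.cup, i⟩ (b i .right) (b (i + 1) .left)
  | cap_outer (i : ℕ) : Equation n a b ⟨.cap, i⟩ (a i .left) (a (i + 1) .right)
  | cap_inner (i : ℕ) : Equation n a b ⟨.cap, i⟩ (a i .right) (a (i + 1) .left)
  | split_left (i : ℕ) : Equation n a b ⟨.split, i⟩ (b i .left) (a i .left)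
  | split_middle (i : ℕ) : Equation n a b ⟨.split, i⟩ (b i .right) (b (i + 1) .left)
  | split_right (i : ℕ) : Equation n a b ⟨.split, i⟩ (b (i + 1) .right) (a i .right)
  | merge_left (i : ℕ) : Equation n a b ⟨.merge, i⟩ (b i .left) (a i .left)
  | merge_middle (i : ℕ) : Equation n a b ⟨.merge, i⟩ (a i .right) (a (i + 1) .left)
  | merge_right (i : ℕ) : Equation n a b ⟨.merge, i⟩ (b i .right) (a (i + 1) .right)
  | leftOver_over (i : ℕ) (σ : Side) :
      Equation n a b ⟨.cross true, i⟩ (b (i + 1) σ) (a i σ)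
  | leftOver_under (i : ℕ) (σ : Side) :
      Equation n a b ⟨.cross true, i⟩ (b i σ) (a (i + 1) σ * (a i .right)⁻¹ * a i .left)
  | rightOver_over (i : ℕ) (σ : Side) :
      Equation n a b ⟨.cross false, i⟩ (b i σ) (a (i + 1) σ)
  | rightOver_under (i : ℕ) (σ : Side) :
      Equation n a b ⟨.cross false, i⟩ (b (i + 1) σ)
        (a i σ * (a (i + 1) .left)⁻¹ * a (i + 1) .right)

namespace Diagram

/-- The relators: the equations of all slices of the diagram. -/
def relators (D : Diagram) : Set (FreeGroup D.Gen) :=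
  {r | ∃ (t : ℕ) (s : Slice) (p q : FreeGroup D.Gen), D.word[t]? = some s ∧
    s.Equation (D.width t) (D.arc t) (D.arc (t + 1)) p q ∧ r = p * q⁻¹}

/-- The group `h(D)` presented by the boundary arcs of the diagram, with two relations for each
crossing; the fundamental heap of the diagram is its group heap `(x, y, z) ↦ x * y⁻¹ * z`.
Each disk contributes a free generator. -/
abbrev fundamentalHeap (D : Diagram) : Type := PresentedGroup D.relators

end Diagram

/-! ### Isotopy: the moves on diagrams -/

/-- The local moves on stacks of slices.  The first group is isotopy of the plane, the second
group consists of the moves that generate isotopy of surface ribbons. -/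
inductive LocalMove : List Slice → List Slice → Prop
  /-- exchange of the heights of two distant events, `e` being to the left of `f` -/
  | exchange (e f : Event) (i d : ℕ) :
      LocalMove [⟨e, i⟩, ⟨f, i + e.cod + d⟩] [⟨f, i + e.dom + d⟩, ⟨e, i⟩]
  /-- cancellation of a minimum and a maximum -/
  | zigzag_left (i : ℕ) : LocalMove [⟨.cup, i⟩, ⟨.cap, i + 1⟩] []
  | zigzag_right (i : ℕ) : LocalMove [⟨.cup, i + 1⟩, ⟨.cap, i⟩] []
  /-- rotation of a vertex in the plane -/
  | rotate_split_left (i : ℕ) : LocalMove [⟨.cup, i⟩, ⟨.merge, i + 1⟩] [⟨.split, i⟩]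
  | rotate_split_right (i : ℕ) : LocalMove [⟨.cup, i + 1⟩, ⟨.merge, i⟩] [⟨.split, i⟩]
  | rotate_merge_left (i : ℕ) : LocalMove [⟨.split, i + 1⟩, ⟨.cap, i⟩] [⟨.merge, i⟩]
  | rotate_merge_right (i : ℕ) : LocalMove [⟨.split, i⟩, ⟨.cap, i + 1⟩] [⟨.merge, i⟩]
  /-- rotation of a crossing in the plane -/
  | rotate_cross_cup (c : Bool) (i : ℕ) :
      LocalMove [⟨.cup, i + 1⟩, ⟨.cross c, i⟩] [⟨.cup, i⟩, ⟨.cross (!c), i + 1⟩]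
  | rotate_cross_cap (c : Bool) (i : ℕ) :
      LocalMove [⟨.cross c, i⟩, ⟨.cap, i + 1⟩] [⟨.cross (!c), i + 1⟩, ⟨.cap, i⟩]
  /-- CL: two successive small loops with opposite crossings cancel -/
  | cancelLoops (c : Bool) (i : ℕ) :
      LocalMove [⟨.cup, i + 1⟩, ⟨.cross c, i⟩, ⟨.cap, i + 1⟩,
        ⟨.cup, i + 1⟩, ⟨.cross (!c), i⟩, ⟨.cap, i + 1⟩] []
  /-- RII -/
  | reidemeisterTwo (c : Bool) (i : ℕ) : LocalMove [⟨.cross c, i⟩, ⟨.cross (!c), i⟩] []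
  /-- RIII; the condition says that the three ribbons lie at three different heights -/
  | reidemeisterThree (a b c : Bool) (i : ℕ) (h : a = b ∨ b = c) :
      LocalMove [⟨.cross a, i⟩, ⟨.cross b, i + 1⟩, ⟨.cross c, i⟩]
        [⟨.cross c, i + 1⟩, ⟨.cross b, i⟩, ⟨.cross a, i + 1⟩]
  /-- YI and IY: a ribbon is moved over (`c = true`) or under (`c = false`) a vertex -/
  | slideVertex (c : Bool) (i : ℕ) :
      LocalMove [⟨.merge, i + 1⟩, ⟨.cross c, i⟩]
        [⟨.cross c, i⟩, ⟨.cross c, i + 1⟩, ⟨.merge, i⟩]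
  /-- IH -/
  | ih (i : ℕ) : LocalMove [⟨.merge, i⟩, ⟨.merge, i⟩] [⟨.merge, i + 1⟩, ⟨.merge, i⟩]

/-- One diagram is obtained from another by a local move; disks are left alone. -/
def Diagram.Move (D E : Diagram) : Prop :=
  D.disks = E.disks ∧ ∃ u v p q : List Slice, LocalMove p q ∧
    D.word = u ++ p ++ v ∧ E.word = u ++ q ++ v

/-- Surface ribbons up to isotopy: diagrams modulo the equivalence relation generated by the
moves. -/
def SurfaceRibbon : Type := Quot Diagram.Move

/-- The surface ribbon represented by a diagram. -/
def Diagram.surfaceRibbon (D : Diagram) : SurfaceRibbon := Quot.mk _ D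

/-- `h(S) ≅ H`: the group `H` is isomorphic to the fundamental heap of `S`, computed from any
diagram of `S`. -/
def SurfaceRibbon.FundamentalHeapIso (S : SurfaceRibbon) (H : Type*) [Group H] : Prop :=
  ∀ D : Diagram, D.surfaceRibbon = S → Nonempty (D.fundamentalHeap ≃* H)

end SurfaceRibbons

/-!
A homomorphism from the group `h(D)` of a diagram to a group `H` is the same as a labelling of the
boundary arcs of `D` (and of its disks) by elements of `H`.  A labelling is described here by its
levels, lists of pairs of labels, and is determined by the labels of the arcs that begin at minima
and at splitting vertices; `Path w a ps b` says that the stack `w` has a labelling with bottom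
level `a`, top level `b` and such beginning labels `ps`.  Accordingly `h(D)` is characterized up to
isomorphism as the group that carries a universal labelling (`IsUniversal`,
`Diagram.exists_isUniversal`).

*Invariance.*  For each local move, the two sides impose the same condition on their bottom and top
levels, and these levels determine the labels in between (`LocalMove.equivalent`).  A universal
labelling of one diagram therefore yields a universal labelling of the other in the same group
(`IsUniversal.replace`), and it is enough to compute `h` for one diagram of each surface.

*Construction.*  A closed comb with ribbons labelled `(v₀, v₁), …, (vₙ₋₁, vₙ)` and `(vₙ, v₀)` has
arbitrary labels `v₀, …, vₙ`, that is, one free generator `v₀` and the elements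
`gᵢ = vᵢ⁻¹ * vᵢ₊₁`.  A ribbon whose two arcs carry the same label `t` is invisible to what passes
under it, so that it can move over the ribbons of the comb without changing any label; passing under
the ribbon `i` on the way there or back, it changes its label to `t * gᵢ⁻¹` or `t * gᵢ`
(`path_circle`, `path_encircle`).  Such a ribbon is made out of the last ribbon of the comb by a
handle, two bands crossing each other, at the cost of one free generator (`path_handle`).  For each
relator `R` the open band of a handle runs around the comb as `R` prescribes and is attached again,
which is possible if and only if `R(g) = 1` (`path_gadget`).  With `n` generators and `m` relators
this gives `F_{m+1} * G`, and `n` disks complete it to `F_{n+m+1} * G`.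
-/

namespace SurfaceRibbons

/-! ### Labellings of the levels of a diagram -/

section Labellings

variable {H K : Type*} [Group H] [Group K]

/-- The condition that an event imposes on the labels `M` of the ribbons below it and the labels
`M'` of the ribbons above it; a ribbon is labelled by the pair of the labels of its left and right
boundary arcs.  The list `ps` records the labels of the arcs that begin at the event (two for a
minimum, one for a vertex that splits a ribbon). -/
def Event.Rel : Event → List (H × H) → List H → List (H × H) → Prop
  | .cup, M, ps, M' => ∃ x y, M = [] ∧ ps = [x, y] ∧ M' = [(x, y), (y, x)]
  | .cap, M, ps, M' => ∃ x y, M = [(x, y), (y, x)] ∧ ps = [] ∧ M' = []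
  | .cross true, M, ps, M' => ∃ x y, M = [x, y] ∧ ps = [] ∧
      M' = [(y.1 * x.2⁻¹ * x.1, y.2 * x.2⁻¹ * x.1), x]
  | .cross false, M, ps, M' => ∃ x y, M = [x, y] ∧ ps = [] ∧
      M' = [y, (x.1 * y.1⁻¹ * y.2, x.2 * y.1⁻¹ * y.2)]
  | .split, M, ps, M' => ∃ x y z, M = [(x, z)] ∧ ps = [y] ∧ M' = [(x, y), (y, z)]
  | .merge, M, ps, M' => ∃ x y z, M = [(x, y), (y, z)] ∧ ps = [] ∧ M' = [(x, z)]

/-- The condition that a slice, with event `e` at a given position, imposes on the labels of the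
levels below and above it. -/
def Step (e : Event) : ℕ → List (H × H) → List H → List (H × H) → Prop
  | 0, a, ps, b => ∃ M M' R, a = M ++ R ∧ b = M' ++ R ∧ e.Rel M ps M'
  | i + 1, a, ps, b => ∃ x a' b', a = x :: a' ∧ b = x :: b' ∧ Step e i a' ps b'

/-- `Path w a ps b` says that the stack `w` has a labelling with bottom labels `a` and top labels
`b`, in which `ps` lists the labels of the arcs that begin at minima and vertices. -/
def Path : List Slice → List (H × H) → List H → List (H × H) → Prop
  | [], a, ps, b => ps = [] ∧ b = a
  | s :: w, a, ps, b => ∃ qs c rs, ps = qs ++ rs ∧ Step s.event s.pos a qs c ∧ Path w c rs b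

/-- The slice `s` with `i` additional ribbons on its left. -/
def Slice.shift (i : ℕ) (s : Slice) : Slice := ⟨s.event, i + s.pos⟩

theorem Event.Rel.length_eq {e : Event} {M M' : List (H × H)} {ps : List H}
    (h : e.Rel M ps M') : M.length = e.dom ∧ M'.length = e.cod := by
  rcases e with _ | _ | (_ | _) | _ | _ <;> simp only [Event.Rel] at h <;>
    grind [Event.dom, Event.cod]

/-- The number of arcs that begin at an event. -/
def Event.births : Event → ℕ
  | .cup => 2
  | .split => 1
  | _ => 0

theorem Event.Rel.births_eq {e : Event} {M M' : List (H × H)} {ps : List H}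
    (h : e.Rel M ps M') : ps.length = e.births := by
  rcases e with _ | _ | (_ | _) | _ | _ <;> simp only [Event.Rel] at h <;>
    grind [Event.births]

theorem Event.Rel.params_unique {e : Event} {M M' : List (H × H)} {ps ps' : List H}
    (h : e.Rel M ps M') (h' : e.Rel M ps' M') : ps = ps' := by
  rcases e with _ | _ | (_ | _) | _ | _ <;> simp only [Event.Rel] at h h' <;> grind

theorem Event.Rel.top_unique {e : Event} {M M₁ M₂ : List (H × H)} {ps : List H}
    (h : e.Rel M ps M₁) (h' : e.Rel M ps M₂) : M₁ = M₂ := by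
  rcases e with _ | _ | (_ | _) | _ | _ <;> simp only [Event.Rel] at h h' <;> grind

theorem Event.Rel.map {e : Event} {M M' : List (H × H)} {ps : List H} (f : H →* K)
    (h : e.Rel M ps M') :
    e.Rel (M.map (Prod.map f f)) (ps.map f) (M'.map (Prod.map f f)) := by
  rcases e with _ | _ | (_ | _) | _ | _ <;> simp only [Event.Rel] at h ⊢
  · obtain ⟨x, y, rfl, rfl, rfl⟩ := h
    exact ⟨f x, f y, by simp⟩
  · obtain ⟨x, y, rfl, rfl, rfl⟩ := h
    exact ⟨f x, f y, by simp⟩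
  · obtain ⟨x, y, rfl, rfl, rfl⟩ := h
    exact ⟨Prod.map f f x, Prod.map f f y, by simp⟩
  · obtain ⟨x, y, rfl, rfl, rfl⟩ := h
    exact ⟨Prod.map f f x, Prod.map f f y, by simp⟩
  · obtain ⟨x, y, z, rfl, rfl, rfl⟩ := h
    exact ⟨f x, f y, f z, by simp⟩
  · obtain ⟨x, y, z, rfl, rfl, rfl⟩ := h
    exact ⟨f x, f y, f z, by simp⟩

/-! ### Labels below and above a slice -/

theorem Step.length_eq {e : Event} {i : ℕ} {a b : List (H × H)} {ps : List H}
    (h : Step e i a ps b) : i + e.dom ≤ a.length ∧ b.length = a.length - e.dom + e.cod := by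
  induction i generalizing a b with
  | zero =>
    obtain ⟨M, M', R, rfl, rfl, h⟩ := h
    have := h.length_eq
    simp only [List.length_append]
    omega
  | succ i ih =>
    obtain ⟨x, a', b', rfl, rfl, h⟩ := h
    have := ih h
    simp only [List.length_cons]
    omega

theorem Step.births_eq {e : Event} {i : ℕ} {a b : List (H × H)} {ps : List H}
    (h : Step e i a ps b) : ps.length = e.births := by
  induction i generalizing a b with
  | zero =>
    obtain ⟨M, M', R, rfl, rfl, h⟩ := h
    exact h.births_eq
  | succ i ih =>
    obtain ⟨x, a', b', rfl, rfl, h⟩ := h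
    exact ih h

theorem Step.params_unique {e : Event} {i : ℕ} {a b : List (H × H)} {ps ps' : List H}
    (h : Step e i a ps b) (h' : Step e i a ps' b) : ps = ps' := by
  induction i generalizing a b with
  | zero =>
    obtain ⟨M, M', R, rfl, rfl, h⟩ := h
    obtain ⟨N, N', R', h1, h2, h'⟩ := h'
    have l := h.length_eq
    have l' := h'.length_eq
    obtain ⟨rfl, -⟩ := List.append_inj h1 (by omega)
    obtain ⟨rfl, -⟩ := List.append_inj h2 (by omega)
    exact h.params_unique h'
  | succ i ih =>
    obtain ⟨x, a', b', rfl, rfl, h⟩ := h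
    obtain ⟨y, c', d', h1, h2, h'⟩ := h'
    simp only [List.cons.injEq] at h1 h2
    obtain ⟨rfl, rfl⟩ := h1
    obtain ⟨-, rfl⟩ := h2
    exact ih h h'

theorem Step.top_unique {e : Event} {i : ℕ} {a b b' : List (H × H)} {ps : List H}
    (h : Step e i a ps b) (h' : Step e i a ps b') : b = b' := by
  induction i generalizing a b b' with
  | zero =>
    obtain ⟨M, M', R, rfl, rfl, h⟩ := h
    obtain ⟨N, N', R', h1, rfl, h'⟩ := h'
    have l := h.length_eq
    have l' := h'.length_eq
    obtain ⟨rfl, rfl⟩ := List.append_inj h1 (by omega)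
    rw [h.top_unique h']
  | succ i ih =>
    obtain ⟨x, a', b', rfl, rfl, h⟩ := h
    obtain ⟨y, c', d', h1, rfl, h'⟩ := h'
    simp only [List.cons.injEq] at h1
    obtain ⟨rfl, rfl⟩ := h1
    rw [ih h h']

theorem Step.map {e : Event} {i : ℕ} {a b : List (H × H)} {ps : List H} (f : H →* K)
    (h : Step e i a ps b) :
    Step e i (a.map (Prod.map f f)) (ps.map f) (b.map (Prod.map f f)) := by
  induction i generalizing a b with
  | zero =>
    obtain ⟨M, M', R, rfl, rfl, h⟩ := h
    exact ⟨_, _, _, List.map_append, List.map_append, h.map f⟩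
  | succ i ih =>
    obtain ⟨x, a', b', rfl, rfl, h⟩ := h
    exact ⟨_, _, _, rfl, rfl, ih h⟩

/-- A slice does not see the ribbons to the left of its event. -/
theorem step_append {e : Event} {k : ℕ} {a b : List (H × H)} {ps : List H} (L : List (H × H)) :
    Step e (L.length + k) (L ++ a) ps b ↔ ∃ b', b = L ++ b' ∧ Step e k a ps b' := by
  induction L generalizing b with
  | nil => simp
  | cons x L ih =>
    rw [List.length_cons, Nat.add_right_comm]
    constructor
    · rintro ⟨y, a', b', h1, rfl, h⟩
      simp only [List.cons_append, List.cons.injEq] at h1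
      obtain ⟨rfl, rfl⟩ := h1
      obtain ⟨b'', rfl, h'⟩ := ih.1 h
      exact ⟨b'', rfl, h'⟩
    · rintro ⟨b', rfl, h⟩
      exact ⟨x, L ++ a, L ++ b', rfl, rfl, ih.2 ⟨b', rfl, h⟩⟩

theorem step_succ_cons {e : Event} {i : ℕ} {x : H × H} {a b : List (H × H)} {ps : List H} :
    Step e (i + 1) (x :: a) ps b ↔ ∃ b', b = x :: b' ∧ Step e i a ps b' := by
  simp [Step]

theorem step_cup {a b : List (H × H)} {ps : List H} :
    Step .cup 0 a ps b ↔ ∃ x y, ps = [x, y] ∧ b = (x, y) :: (y, x) :: a := by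
  simp only [Step, Event.Rel]
  constructor
  · rintro ⟨_, _, R, rfl, rfl, x, y, rfl, rfl, rfl⟩
    exact ⟨x, y, rfl, rfl⟩
  · rintro ⟨x, y, rfl, rfl⟩
    exact ⟨_, _, a, rfl, rfl, x, y, rfl, rfl, rfl⟩

theorem step_cap {a b : List (H × H)} {ps : List H} :
    Step .cap 0 a ps b ↔ ps = [] ∧ ∃ x y, a = (x, y) :: (y, x) :: b := by
  simp only [Step, Event.Rel]
  constructor
  · rintro ⟨_, _, R, rfl, rfl, x, y, rfl, rfl, rfl⟩
    exact ⟨rfl, x, y, rfl⟩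
  · rintro ⟨rfl, x, y, rfl⟩
    exact ⟨_, _, b, rfl, rfl, x, y, rfl, rfl, rfl⟩

theorem step_cross_true {a b : List (H × H)} {ps : List H} :
    Step (.cross true) 0 a ps b ↔ ps = [] ∧ ∃ x y R, a = x :: y :: R ∧
      b = (y.1 * x.2⁻¹ * x.1, y.2 * x.2⁻¹ * x.1) :: x :: R := by
  simp only [Step, Event.Rel]
  constructor
  · rintro ⟨_, _, R, rfl, rfl, x, y, rfl, rfl, rfl⟩
    exact ⟨rfl, x, y, R, rfl, rfl⟩
  · rintro ⟨rfl, x, y, R, rfl, rfl⟩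
    exact ⟨_, _, R, rfl, rfl, x, y, rfl, rfl, rfl⟩

theorem step_cross_false {a b : List (H × H)} {ps : List H} :
    Step (.cross false) 0 a ps b ↔ ps = [] ∧ ∃ x y R, a = x :: y :: R ∧
      b = y :: (x.1 * y.1⁻¹ * y.2, x.2 * y.1⁻¹ * y.2) :: R := by
  simp only [Step, Event.Rel]
  constructor
  · rintro ⟨_, _, R, rfl, rfl, x, y, rfl, rfl, rfl⟩
    exact ⟨rfl, x, y, R, rfl, rfl⟩
  · rintro ⟨rfl, x, y, R, rfl, rfl⟩
    exact ⟨_, _, R, rfl, rfl, x, y, rfl, rfl, rfl⟩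

theorem step_split {a b : List (H × H)} {ps : List H} :
    Step .split 0 a ps b ↔ ∃ x y z R, ps = [y] ∧ a = (x, z) :: R ∧
      b = (x, y) :: (y, z) :: R := by
  simp only [Step, Event.Rel]
  constructor
  · rintro ⟨_, _, R, rfl, rfl, x, y, z, rfl, rfl, rfl⟩
    exact ⟨x, y, z, R, rfl, rfl, rfl⟩
  · rintro ⟨x, y, z, R, rfl, rfl, rfl⟩
    exact ⟨_, _, R, rfl, rfl, x, y, z, rfl, rfl, rfl⟩

theorem step_merge {a b : List (H × H)} {ps : List H} :
    Step .merge 0 a ps b ↔ ps = [] ∧ ∃ x y z R, a = (x, y) :: (y, z) :: R ∧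
      b = (x, z) :: R := by
  simp only [Step, Event.Rel]
  constructor
  · rintro ⟨_, _, R, rfl, rfl, x, y, z, rfl, rfl, rfl⟩
    exact ⟨rfl, x, y, z, R, rfl, rfl⟩
  · rintro ⟨rfl, x, y, z, R, rfl, rfl⟩
    exact ⟨_, _, R, rfl, rfl, x, y, z, rfl, rfl, rfl⟩

/-! ### Labellings of stacks of slices -/

theorem path_append {u v : List Slice} {a b : List (H × H)} {ps : List H} :
    Path (u ++ v) a ps b ↔
      ∃ qs c rs, ps = qs ++ rs ∧ Path u a qs c ∧ Path v c rs b := by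
  induction u generalizing a ps with
  | nil => simp [Path]
  | cons s u ih =>
    simp only [List.cons_append, Path, ih]
    constructor
    · rintro ⟨qs, c, _, rfl, h, qs', c', rs', rfl, h', h''⟩
      exact ⟨qs ++ qs', c', rs', (List.append_assoc ..).symm, ⟨qs, c, qs', rfl, h, h'⟩, h''⟩
    · rintro ⟨_, c', rs', rfl, ⟨qs, c, qs', rfl, h, h'⟩, h''⟩
      exact ⟨qs, c, _, List.append_assoc .., h, qs', c', rs', rfl, h', h''⟩

theorem Path.append {u v : List Slice} {a b c : List (H × H)} {ps qs : List H}
    (h : Path u a ps c) (h' : Path v c qs b) : Path (u ++ v) a (ps ++ qs) b :=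
  path_append.2 ⟨_, _, _, rfl, h, h'⟩

theorem path_singleton {s : Slice} {a b : List (H × H)} {ps : List H} :
    Path [s] a ps b ↔ Step s.event s.pos a ps b := by
  simp [Path]

/-- The number of beginning labels depends on the stack only, so that a concatenation of such lists
can be taken apart. -/
theorem Path.births_eq {w : List Slice} {a b : List (H × H)} {ps : List H}
    (h : Path w a ps b) : ps.length = (w.map fun s => s.event.births).sum := by
  induction w generalizing a ps with
  | nil => simp [h.1]
  | cons s w ih =>
    obtain ⟨qs, c, rs, rfl, h, h'⟩ := h
    simp [h.births_eq, ih h']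

/-- The bottom level and the beginning labels determine the whole labelling. -/
theorem Path.top_unique {w : List Slice} {a b b' : List (H × H)} {ps : List H}
    (h : Path w a ps b) (h' : Path w a ps b') : b = b' := by
  induction w generalizing a ps with
  | nil => rw [h.2, h'.2]
  | cons s w ih =>
    obtain ⟨qs, c, rs, rfl, h1, h2⟩ := h
    obtain ⟨qs', c', rs', h3, h1', h2'⟩ := h'
    obtain ⟨rfl, rfl⟩ := List.append_inj h3 (by rw [h1.births_eq, h1'.births_eq])
    obtain rfl := h1.top_unique h1'
    exact ih h2 h2'

theorem Path.map {w : List Slice} {a b : List (H × H)} {ps : List H} (f : H →* K)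
    (h : Path w a ps b) : Path w (a.map (Prod.map f f)) (ps.map f) (b.map (Prod.map f f)) := by
  induction w generalizing a ps with
  | nil =>
    obtain ⟨rfl, rfl⟩ := h
    exact ⟨rfl, rfl⟩
  | cons s w ih =>
    obtain ⟨qs, c, rs, rfl, h1, h2⟩ := h
    exact ⟨_, _, _, List.map_append, h1.map f, ih h2⟩

/-- A stack that has a labelling fits together. -/
theorem Path.fits {w : List Slice} {a : List (H × H)} {ps : List H}
    (h : Path w a ps []) : Fits a.length w := by
  induction w generalizing a ps with
  | nil => simp [Fits, ← h.2]
  | cons s w ih =>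
    obtain ⟨qs, c, rs, rfl, h1, h2⟩ := h
    have := h1.length_eq
    refine ⟨this.1, ?_⟩
    have h3 := ih h2
    rwa [this.2] at h3

theorem path_shift {w : List Slice} {a b : List (H × H)} {ps : List H} (L : List (H × H)) :
    Path (w.map (Slice.shift L.length)) (L ++ a) ps b ↔
      ∃ b', b = L ++ b' ∧ Path w a ps b' := by
  induction w generalizing a ps with
  | nil => simp [Path, and_comm]
  | cons s w ih =>
    simp only [List.map_cons, Path, Slice.shift, step_append]
    constructor
    · rintro ⟨qs, _, rs, rfl, ⟨c, rfl, h1⟩, h2⟩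
      obtain ⟨b', rfl, h3⟩ := ih.1 h2
      exact ⟨b', rfl, qs, c, rs, rfl, h1, h3⟩
    · rintro ⟨b', rfl, qs, c, rs, rfl, h1, h2⟩
      exact ⟨qs, _, rs, rfl, ⟨c, rfl, h1⟩, ih.2 ⟨b', rfl, h2⟩⟩

end Labellings

/-! ### Invariance of labellings under the local moves -/

/-- Two stacks impose the same condition on their bottom and top labels, provided that there are at
least `k` ribbons at the bottom, and the labels at the bottom and the top determine the rest of the
labelling. -/
structure Equivalent (k : ℕ) (p q : List Slice) : Prop where
  exists_iff : ∀ {H : Type} [Group H] (a b : List (H × H)), k ≤ a.length →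
    ((∃ ps, Path p a ps b) ↔ ∃ ps, Path q a ps b)
  unique_left : ∀ {H : Type} [Group H] (a b : List (H × H)) (ps ps' : List H),
    Path p a ps b → Path p a ps' b → ps = ps'
  unique_right : ∀ {H : Type} [Group H] (a b : List (H × H)) (ps ps' : List H),
    Path q a ps b → Path q a ps' b → ps = ps'

theorem Path.shift_le_length {H : Type} [Group H] {i : ℕ} {s : Slice} {w : List Slice}
    {a b : List (H × H)} {ps : List H}
    (h : Path ((s :: w).map (Slice.shift i)) a ps b) : i ≤ a.length := by
  obtain ⟨qs, c, rs, rfl, h, -⟩ := h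
  have := h.length_eq.1
  simp only [Slice.shift] at this
  omega

/-- `path_shift` for a bottom level that is not given as a concatenation. -/
theorem path_shift_iff {H : Type} [Group H] {i : ℕ} {w : List Slice} {a b : List (H × H)}
    {ps : List H} (hi : i ≤ a.length) :
    Path (w.map (Slice.shift i)) a ps b ↔
      ∃ b', b = a.take i ++ b' ∧ Path w (a.drop i) ps b' := by
  have h := path_shift (w := w) (a := a.drop i) (b := b) (ps := ps) (a.take i)
  rwa [List.length_take_of_le hi, List.take_append_drop] at h

/-- Equivalent stacks stay equivalent when ribbons are added on the left. -/
theorem Equivalent.shift {k : ℕ} {p q : List Slice} (h : Equivalent k p q) (i : ℕ) :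
    Equivalent (i + k) (p.map (Slice.shift i)) (q.map (Slice.shift i)) := by
  have unique : ∀ {w : List Slice}, (∀ {H : Type} [Group H] (a b : List (H × H)) (ps ps' : List H),
      Path w a ps b → Path w a ps' b → ps = ps') →
      ∀ {H : Type} [Group H] (a b : List (H × H)) (ps ps' : List H),
        Path (w.map (Slice.shift i)) a ps b → Path (w.map (Slice.shift i)) a ps' b → ps = ps' := by
    intro w hw H _ a b ps ps' h1 h2
    rcases w with _ | ⟨s, w⟩
    · exact h1.1.trans h2.1.symm
    · have hi := h1.shift_le_length
      rw [path_shift_iff hi] at h1 h2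
      obtain ⟨b', rfl, h1⟩ := h1
      obtain ⟨b'', h3, h2⟩ := h2
      obtain rfl := List.append_cancel_left h3
      exact hw _ _ _ _ h1 h2
  refine ⟨fun a b hk => ?_, unique h.unique_left, unique h.unique_right⟩
  have hi : i ≤ a.length := by omega
  simp only [path_shift_iff hi]
  have := fun b' => h.exists_iff (a.drop i) b' (by rw [List.length_drop]; omega)
  constructor
  · rintro ⟨ps, b', rfl, h⟩
    obtain ⟨qs, h⟩ := (this b').1 ⟨ps, h⟩
    exact ⟨qs, b', rfl, h⟩
  · rintro ⟨ps, b', rfl, h⟩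
    obtain ⟨qs, h⟩ := (this b').2 ⟨ps, h⟩
    exact ⟨qs, b', rfl, h⟩

theorem step_one {H : Type} [Group H] {e : Event} {a b : List (H × H)} {ps : List H} :
    Step e 1 a ps b ↔ ∃ x a' b', a = x :: a' ∧ b = x :: b' ∧ Step e 0 a' ps b' :=
  Iff.rfl

/-- A criterion for a stack to be equivalent to the empty one. -/
theorem Equivalent.nil {k : ℕ} {p : List Slice}
    (h₁ : ∀ {H : Type} [Group H] (a b : List (H × H)) (ps : List H), Path p a ps b → b = a)
    (h₂ : ∀ {H : Type} [Group H] (a : List (H × H)), k ≤ a.length → ∃ ps, Path p a ps a)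
    (h₃ : ∀ {H : Type} [Group H] (a b : List (H × H)) (ps ps' : List H),
      Path p a ps b → Path p a ps' b → ps = ps') : Equivalent k p [] := by
  refine ⟨fun a b hk => ⟨?_, ?_⟩, h₃, fun a b ps ps' h h' => h.1.trans h'.1.symm⟩
  · rintro ⟨ps, h⟩
    exact ⟨[], rfl, h₁ _ _ _ h⟩
  · rintro ⟨ps, rfl, rfl⟩
    exact h₂ b hk

theorem equivalent_zigzag_left : Equivalent 1 [⟨.cup, 0⟩, ⟨.cap, 1⟩] [] := by
  apply Equivalent.nil
  · intro H _ a b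
    simp only [Path, step_one, step_cup, step_cap]
    grind
  · rintro H _ (_ | ⟨⟨x, y⟩, R⟩) h
    · simp at h
    · exact ⟨[x, y], by simp [Path, step_one, step_cup, step_cap]⟩
  · intro H _ a b
    simp only [Path, step_one, step_cup, step_cap]
    grind

theorem equivalent_zigzag_right : Equivalent 1 [⟨.cup, 1⟩, ⟨.cap, 0⟩] [] := by
  apply Equivalent.nil
  · intro H _ a b
    simp only [Path, step_one, step_cup, step_cap]
    grind
  · rintro H _ (_ | ⟨⟨x, y⟩, R⟩) h
    · simp at h
    · exact ⟨[y, x], by simp [Path, step_one, step_cup, step_cap]⟩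
  · intro H _ a b
    simp only [Path, step_one, step_cup, step_cap]
    grind

theorem equivalent_rotate_split_left :
    Equivalent 0 [⟨.cup, 0⟩, ⟨.merge, 1⟩] [⟨.split, 0⟩] := by
  constructor <;> intro H _ a b <;>
    simp only [Path, step_one, step_cup, step_merge, step_split] <;> grind

theorem equivalent_rotate_split_right :
    Equivalent 0 [⟨.cup, 1⟩, ⟨.merge, 0⟩] [⟨.split, 0⟩] := by
  constructor <;> intro H _ a b <;>
    simp only [Path, step_one, step_cup, step_merge, step_split] <;> grind

theorem equivalent_rotate_merge_left :
    Equivalent 0 [⟨.split, 1⟩, ⟨.cap, 0⟩] [⟨.merge, 0⟩] := by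
  constructor <;> intro H _ a b <;>
    simp only [Path, step_one, step_cap, step_merge, step_split] <;> grind

theorem equivalent_rotate_merge_right :
    Equivalent 0 [⟨.split, 0⟩, ⟨.cap, 1⟩] [⟨.merge, 0⟩] := by
  constructor <;> intro H _ a b <;>
    simp only [Path, step_one, step_cap, step_merge, step_split] <;> grind

theorem equivalent_ih :
    Equivalent 0 [⟨.merge, 0⟩, ⟨.merge, 0⟩] [⟨.merge, 1⟩, ⟨.merge, 0⟩] := by
  constructor <;> intro H _ a b <;>
    simp only [Path, step_one, step_merge] <;> grind

section Crossings

variable {H : Type} [Group H]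

/-- The labels of a ribbon with labels `y` after passing under a ribbon with labels `x`, first under
the right boundary arc. -/
def underLeft (x y : H × H) : H × H := (y.1 * x.2⁻¹ * x.1, y.2 * x.2⁻¹ * x.1)

/-- The labels of a ribbon with labels `y` after passing under a ribbon with labels `x`, first under
the left boundary arc. -/
def underRight (x y : H × H) : H × H := (y.1 * x.1⁻¹ * x.2, y.2 * x.1⁻¹ * x.2)

theorem underRight_underLeft (x y : H × H) : underRight x (underLeft x y) = y := by
  simp [underRight, underLeft]

theorem underLeft_underRight (x y : H × H) : underLeft x (underRight x y) = y := by
  simp [underRight, underLeft]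

theorem underLeft_swap (x y : H × H) : underLeft x y.swap = (underLeft x y).swap := rfl

theorem underLeft_swap_left (x y : H × H) : underLeft x.swap y = underRight x y := rfl

theorem underRight_swap (x y : H × H) : underRight x y.swap = (underRight x y).swap := rfl

/-- The labels above a crossing of ribbons with labels `x` and `y` below it. -/
def crossing : Bool → H × H → H × H → (H × H) × (H × H)
  | true, x, y => (underLeft x y, x)
  | false, x, y => (y, underRight y x)

theorem step_cross {c : Bool} {a b : List (H × H)} {ps : List H} :
    Step (.cross c) 0 a ps b ↔ ps = [] ∧ ∃ x y R, a = x :: y :: R ∧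
      b = (crossing c x y).1 :: (crossing c x y).2 :: R := by
  cases c
  · exact step_cross_false
  · exact step_cross_true

theorem crossing_crossing_not (c : Bool) (x y : H × H) :
    crossing (!c) (crossing c x y).1 (crossing c x y).2 = (x, y) := by
  cases c <;> simp [crossing, underRight_underLeft, underLeft_underRight]

/-- The two sides of RIII give the same labels at the top.  The condition on the crossings is
needed: without it each ribbon passes over one of the other two and under the other one. -/
theorem crossing_reidemeisterThree {a b c : Bool} (h : a = b ∨ b = c) (x y z : H × H) :
    let u := crossing a x y
    let v := crossing b u.2 z
    let w := crossing c u.1 v.1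
    let u' := crossing c y z
    let v' := crossing b x u'.1
    let w' := crossing a v'.2 u'.2
    w.1 = v'.1 ∧ w.2 = w'.1 ∧ v.2 = w'.2 := by
  revert h
  cases a <;> cases b <;> cases c <;> simp [crossing, underLeft, underRight, mul_assoc]

theorem path_nil {a b : List (H × H)} {ps : List H} : Path [] a ps b ↔ ps = [] ∧ b = a :=
  Iff.rfl

theorem path_cons_cup {w : List Slice} {a b : List (H × H)} {ps : List H} :
    Path (⟨.cup, 0⟩ :: w) a ps b ↔
      ∃ z qs, ps = z.1 :: z.2 :: qs ∧ Path w (z :: z.swap :: a) qs b := by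
  simp only [Path, step_cup]
  constructor
  · rintro ⟨_, _, qs, rfl, ⟨x, y, rfl, rfl⟩, h⟩
    exact ⟨(x, y), qs, rfl, h⟩
  · rintro ⟨⟨x, y⟩, qs, rfl, h⟩
    exact ⟨[x, y], _, qs, rfl, ⟨x, y, rfl, rfl⟩, h⟩

theorem path_cons_cup_one {w : List Slice} {x : H × H} {a b : List (H × H)} {ps : List H} :
    Path (⟨.cup, 1⟩ :: w) (x :: a) ps b ↔
      ∃ z qs, ps = z.1 :: z.2 :: qs ∧ Path w (x :: z :: z.swap :: a) qs b := by
  simp only [Path, step_succ_cons, step_cup]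
  constructor
  · rintro ⟨_, _, qs, rfl, ⟨_, rfl, x, y, rfl, rfl⟩, h⟩
    exact ⟨(x, y), qs, rfl, h⟩
  · rintro ⟨⟨x, y⟩, qs, rfl, h⟩
    exact ⟨[x, y], _, qs, rfl, ⟨_, rfl, x, y, rfl, rfl⟩, h⟩

theorem path_cons_cross {c : Bool} {w : List Slice} {x y : H × H} {a b : List (H × H)}
    {ps : List H} :
    Path (⟨.cross c, 0⟩ :: w) (x :: y :: a) ps b ↔
      Path w ((crossing c x y).1 :: (crossing c x y).2 :: a) ps b := by
  simp only [Path, step_cross]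
  constructor
  · rintro ⟨_, _, qs, rfl, ⟨rfl, x, y, R, h, rfl⟩, h'⟩
    simp only [List.cons.injEq] at h
    obtain ⟨rfl, rfl, rfl⟩ := h
    exact h'
  · intro h
    exact ⟨[], _, _, rfl, ⟨rfl, _, _, _, rfl, rfl⟩, h⟩

theorem path_cons_cross_one {c : Bool} {w : List Slice} {x y z : H × H} {a b : List (H × H)}
    {ps : List H} :
    Path (⟨.cross c, 1⟩ :: w) (z :: x :: y :: a) ps b ↔
      Path w (z :: (crossing c x y).1 :: (crossing c x y).2 :: a) ps b := by
  simp only [Path, step_succ_cons, step_cross]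
  constructor
  · rintro ⟨_, _, qs, rfl, ⟨_, rfl, rfl, x, y, R, h, rfl⟩, h'⟩
    simp only [List.cons.injEq] at h
    obtain ⟨rfl, rfl, rfl⟩ := h
    exact h'
  · intro h
    exact ⟨[], _, _, rfl, ⟨_, rfl, rfl, _, _, _, rfl, rfl⟩, h⟩

theorem path_cons_cap {w : List Slice} {x y : H × H} {a b : List (H × H)} {ps : List H} :
    Path (⟨.cap, 0⟩ :: w) (x :: y :: a) ps b ↔ y = x.swap ∧ Path w a ps b := by
  simp only [Path, step_cap]
  constructor
  · rintro ⟨_, _, qs, rfl, ⟨rfl, x, y, h⟩, h'⟩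
    simp only [List.cons.injEq] at h
    obtain ⟨rfl, rfl, rfl⟩ := h
    exact ⟨rfl, h'⟩
  · rintro ⟨rfl, h⟩
    exact ⟨[], _, _, rfl, ⟨rfl, _, _, rfl⟩, h⟩

theorem path_cons_cap_one {w : List Slice} {x y z : H × H} {a b : List (H × H)} {ps : List H} :
    Path (⟨.cap, 1⟩ :: w) (z :: x :: y :: a) ps b ↔ y = x.swap ∧ Path w (z :: a) ps b := by
  simp only [Path, step_succ_cons, step_cap]
  constructor
  · rintro ⟨_, _, qs, rfl, ⟨_, rfl, rfl, x, y, h⟩, h'⟩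
    simp only [List.cons.injEq] at h
    obtain ⟨rfl, rfl, rfl⟩ := h
    exact ⟨rfl, h'⟩
  · rintro ⟨rfl, h⟩
    exact ⟨[], _, _, rfl, ⟨_, rfl, rfl, _, _, rfl⟩, h⟩

theorem path_cons_merge {w : List Slice} {x y : H × H} {a b : List (H × H)} {ps : List H} :
    Path (⟨.merge, 0⟩ :: w) (x :: y :: a) ps b ↔ y.1 = x.2 ∧ Path w ((x.1, y.2) :: a) ps b := by
  simp only [Path, step_merge]
  constructor
  · rintro ⟨_, _, qs, rfl, ⟨rfl, x, y, z, R, h, rfl⟩, h'⟩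
    simp only [List.cons.injEq] at h
    obtain ⟨rfl, rfl, rfl⟩ := h
    exact ⟨rfl, h'⟩
  · obtain ⟨y₁, y₂⟩ := y
    rintro ⟨rfl, h⟩
    exact ⟨[], _, _, rfl, ⟨rfl, _, _, _, _, rfl, rfl⟩, h⟩

theorem path_cons_merge_one {w : List Slice} {x y z : H × H} {a b : List (H × H)} {ps : List H} :
    Path (⟨.merge, 1⟩ :: w) (z :: x :: y :: a) ps b ↔
      y.1 = x.2 ∧ Path w (z :: (x.1, y.2) :: a) ps b := by
  simp only [Path, step_succ_cons, step_merge]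
  constructor
  · rintro ⟨_, _, qs, rfl, ⟨_, rfl, rfl, x, y, z, R, h, rfl⟩, h'⟩
    simp only [List.cons.injEq] at h
    obtain ⟨rfl, rfl, rfl⟩ := h
    exact ⟨rfl, h'⟩
  · obtain ⟨y₁, y₂⟩ := y
    rintro ⟨rfl, h⟩
    exact ⟨[], _, _, rfl, ⟨_, rfl, rfl, _, _, _, _, rfl, rfl⟩, h⟩

/-- The bottom level of a stack is at least as long as its first slice requires. -/
theorem Path.le_length {s : Slice} {w : List Slice} {a b : List (H × H)} {ps : List H}
    (h : Path (s :: w) a ps b) : s.pos + s.event.dom ≤ a.length := by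
  obtain ⟨_, _, _, -, h, -⟩ := h
  exact h.length_eq.1

/-- To show that two stacks are equivalent, it is enough to consider bottom levels with at least `k`
ribbons if neither stack fits on a level with fewer ribbons. -/
theorem Equivalent.of_le {k : ℕ} (l : ℕ) {p q : List Slice}
    (hp : ∀ {H : Type} [Group H] (a b : List (H × H)) ps, Path p a ps b → k ≤ a.length)
    (hq : ∀ {H : Type} [Group H] (a b : List (H × H)) ps, Path q a ps b → k ≤ a.length)
    (h : Equivalent k p q) : Equivalent l p q := by
  refine ⟨fun a b hl => ⟨?_, ?_⟩, h.unique_left, h.unique_right⟩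
  · rintro ⟨ps, h'⟩
    exact (h.exists_iff a b (hp _ _ _ h')).1 ⟨ps, h'⟩
  · rintro ⟨ps, h'⟩
    exact (h.exists_iff a b (hq _ _ _ h')).2 ⟨ps, h'⟩

theorem Path.le_length_two {H : Type} [Group H] {s t : Slice} {w : List Slice} {a b : List (H × H)}
    {ps : List H} (h : Path (s :: t :: w) a ps b) :
    t.pos + t.event.dom + s.event.dom ≤ a.length + s.event.cod := by
  obtain ⟨_, _, _, -, h, _, _, _, -, h', -⟩ := h
  have := h.length_eq
  have := h'.length_eq
  omega

/-- For stacks without minima and splitting vertices there are no labels besides those that the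
bottom level determines. -/
theorem Equivalent.of_births_eq_zero {k : ℕ} {p q : List Slice}
    (hp : (p.map fun s => s.event.births).sum = 0) (hq : (q.map fun s => s.event.births).sum = 0)
    (h : ∀ {H : Type} [Group H] (a b : List (H × H)) (ps : List H), k ≤ a.length →
      (Path p a ps b ↔ Path q a ps b)) : Equivalent k p q := by
  refine ⟨fun a b hk => exists_congr fun ps => h a b ps hk, ?_, ?_⟩
  · intro H _ a b ps ps' h h'
    rw [List.length_eq_zero_iff.1 (h.births_eq.trans hp),
      List.length_eq_zero_iff.1 (h'.births_eq.trans hp)]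
  · intro H _ a b ps ps' h h'
    rw [List.length_eq_zero_iff.1 (h.births_eq.trans hq),
      List.length_eq_zero_iff.1 (h'.births_eq.trans hq)]

theorem equivalent_cross_cross (c : Bool) : Equivalent 2 [⟨.cross c, 0⟩, ⟨.cross (!c), 0⟩] [] := by
  apply Equivalent.of_births_eq_zero rfl rfl
  rintro H _ (_ | ⟨x, _ | ⟨y, R⟩⟩) b ps hk
  · simp at hk
  · simp at hk
  · simp [path_cons_cross, crossing_crossing_not]

theorem equivalent_reidemeisterThree (a b c : Bool) (h : a = b ∨ b = c) :
    Equivalent 0 [⟨.cross a, 0⟩, ⟨.cross b, 1⟩, ⟨.cross c, 0⟩]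
        [⟨.cross c, 1⟩, ⟨.cross b, 0⟩, ⟨.cross a, 1⟩] := by
  apply Equivalent.of_le (k := 3) 0
  · intro H _ A B ps h
    have := h.le_length_two
    simpa [Event.dom, Event.cod] using this
  · intro H _ A B ps h
    exact h.le_length
  apply Equivalent.of_births_eq_zero rfl rfl
  rintro H _ (_ | ⟨x, _ | ⟨y, _ | ⟨z, R⟩⟩⟩) B ps hk
  · simp at hk
  · simp at hk
  · simp at hk
  · obtain ⟨h1, h2, h3⟩ := crossing_reidemeisterThree h x y z
    simp only [path_cons_cross, path_cons_cross_one, path_nil, h1, h2, h3]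

theorem equivalent_slideVertex (c : Bool) :
    Equivalent 0 [⟨.merge, 1⟩, ⟨.cross c, 0⟩]
        [⟨.cross c, 0⟩, ⟨.cross c, 1⟩, ⟨.merge, 0⟩] := by
  apply Equivalent.of_le (k := 3) 0
  · intro H _ A B ps h
    exact h.le_length
  · intro H _ A B ps h
    have := h.le_length_two
    simpa [Event.dom, Event.cod] using this
  apply Equivalent.of_births_eq_zero rfl rfl
  rintro H _ (_ | ⟨x, _ | ⟨y, _ | ⟨z, R⟩⟩⟩) B ps hk
  · simp at hk
  · simp at hk
  · simp at hk
  · simp only [path_cons_cross, path_cons_cross_one, path_cons_merge, path_cons_merge_one, path_nil]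
    cases c
    · refine and_congr_right fun h => ?_
      simp [crossing, underRight, h, mul_assoc]
    · simp only [crossing, underLeft, mul_left_inj]

theorem equivalent_rotate_cross_cap (c : Bool) :
    Equivalent 0 [⟨.cross c, 0⟩, ⟨.cap, 1⟩] [⟨.cross (!c), 1⟩, ⟨.cap, 0⟩] := by
  apply Equivalent.of_le (k := 3) 0
  · intro H _ A B ps h
    have := h.le_length_two
    simpa [Event.dom, Event.cod] using this
  · intro H _ A B ps h
    exact h.le_length
  apply Equivalent.of_births_eq_zero rfl rfl
  rintro H _ (_ | ⟨x, _ | ⟨y, _ | ⟨z, R⟩⟩⟩) B ps hk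
  · simp at hk
  · simp at hk
  · simp at hk
  · simp only [path_cons_cross, path_cons_cross_one, path_cons_cap, path_cons_cap_one, path_nil]
    cases c
    · rw [show z = (crossing false x y).2.swap ↔ (crossing (!false) y z).1 = x.swap by
        simp only [crossing, Bool.not_false]
        constructor
        · rintro rfl
          rw [← underRight_swap, underLeft_underRight]
        · intro h
          rw [← underRight_swap, ← h, underRight_underLeft]]
      refine and_congr_right fun h => ?_
      simp [crossing]
    · simp only [crossing, Bool.not_true]
      refine and_congr_right fun h => ?_
      subst h
      rfl

theorem equivalent_rotate_cross_cup (c : Bool) :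
    Equivalent 0 [⟨.cup, 1⟩, ⟨.cross c, 0⟩] [⟨.cup, 0⟩, ⟨.cross (!c), 1⟩] := by
  apply Equivalent.of_le (k := 1) 0
  · intro H _ A B ps h
    exact h.le_length
  · intro H _ A B ps h
    have := h.le_length_two
    simpa [Event.dom, Event.cod] using this
  have h₁ : ∀ {H : Type} [Group H] {x : H × H} {R b : List (H × H)} {ps : List H},
      Path [⟨.cup, 1⟩, ⟨.cross c, 0⟩] (x :: R) ps b ↔ ∃ z : H × H, ps = [z.1, z.2] ∧
        b = (crossing c x z).1 :: (crossing c x z).2 :: z.swap :: R := by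
    intro H _ x R b ps
    simp [path_cons_cup_one, path_cons_cross, path_nil]
  have h₂ : ∀ {H : Type} [Group H] {x : H × H} {R b : List (H × H)} {ps : List H},
      Path [⟨.cup, 0⟩, ⟨.cross (!c), 1⟩] (x :: R) ps b ↔ ∃ z : H × H, ps = [z.1, z.2] ∧
        b = z :: (crossing (!c) z.swap x).1 :: (crossing (!c) z.swap x).2 :: R := by
    intro H _ x R b ps
    simp [path_cons_cup, path_cons_cross_one, path_nil]
  refine ⟨?_, ?_, ?_⟩
  · rintro H _ (_ | ⟨x, R⟩) b hk
    · simp at hk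
    simp only [h₁, h₂]
    constructor
    · rintro ⟨ps, z, rfl, rfl⟩
      refine ⟨_, (crossing c x z).1, rfl, ?_⟩
      cases c <;> simp [crossing, ← underLeft_swap, underLeft_swap_left, underRight_underLeft]
    · rintro ⟨ps, z, rfl, rfl⟩
      refine ⟨_, (crossing (!c) z.swap x).2.swap, rfl, ?_⟩
      cases c <;> simp [crossing, ← underRight_swap, underLeft_swap_left, underLeft_underRight]
  · rintro H _ (_ | ⟨x, R⟩) b ps ps' h h'
    · simpa using h.le_length
    rw [h₁] at h h'
    obtain ⟨z, rfl, rfl⟩ := h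
    obtain ⟨z', rfl, h'⟩ := h'
    simp only [List.cons.injEq, Prod.swap_inj] at h'
    rw [h'.2.2.1]
  · rintro H _ (_ | ⟨x, R⟩) b ps ps' h h'
    · simpa [Event.dom, Event.cod] using h.le_length_two
    rw [h₂] at h h'
    obtain ⟨z, rfl, rfl⟩ := h
    obtain ⟨z', rfl, h'⟩ := h'
    simp only [List.cons.injEq] at h'
    rw [h'.1]

/-- The labels of the strand of a small loop, formed by a ribbon with labels `x`, that begins at the
minimum of the loop and crosses the ribbon. -/
def loopStrand : Bool → H × H → H × H
  | true, x => x
  | false, x => (x.2, x.2 * x.1⁻¹ * x.2)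

/-- The maximum of a small loop joins the strand of the loop, with labels `z`, to the ribbon after
the crossing; this fixes `z`. -/
theorem eq_crossing_iff (c : Bool) (x z : H × H) :
    z = (crossing c x z).2 ↔ z = loopStrand c x := by
  cases c
  · obtain ⟨x₁, x₂⟩ := x
    obtain ⟨z₁, z₂⟩ := z
    simp only [crossing, underRight, loopStrand, Prod.mk.injEq]
    constructor
    · rintro ⟨h1, h2⟩
      have h3 : z₁ = x₂ := by
        rw [mul_assoc, ← mul_inv_eq_iff_eq_mul, mul_inv_rev, inv_inv, mul_inv_cancel_left] at h2
        exact h2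
      subst h3
      refine ⟨rfl, ?_⟩
      nth_rw 2 [h1]
      group
    · rintro ⟨rfl, rfl⟩
      constructor <;> group
  · rfl


/-- The labels of a ribbon with labels `x` after a small loop. -/
def afterLoop (c : Bool) (x : H × H) : H × H := (crossing c x (loopStrand c x)).1

theorem afterLoop_afterLoop_not (c : Bool) (x : H × H) : afterLoop (!c) (afterLoop c x) = x := by
  cases c <;> simp [afterLoop, crossing, loopStrand, underLeft, mul_assoc]

theorem path_cons_loop {c : Bool} {w : List Slice} {x : H × H} {a b : List (H × H)} {ps : List H} :
    Path (⟨.cup, 1⟩ :: ⟨.cross c, 0⟩ :: ⟨.cap, 1⟩ :: w) (x :: a) ps b ↔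
      ∃ qs, ps = (loopStrand c x).1 :: (loopStrand c x).2 :: qs ∧
        Path w (afterLoop c x :: a) qs b := by
  simp only [path_cons_cup_one, path_cons_cross, path_cons_cap_one, Prod.swap_inj, eq_crossing_iff]
  constructor
  · rintro ⟨z, qs, rfl, rfl, h⟩
    exact ⟨qs, rfl, h⟩
  · rintro ⟨qs, rfl, h⟩
    exact ⟨_, qs, rfl, rfl, h⟩

theorem equivalent_cancelLoops (c : Bool) :
    Equivalent 1 [⟨.cup, 1⟩, ⟨.cross c, 0⟩, ⟨.cap, 1⟩,
      ⟨.cup, 1⟩, ⟨.cross (!c), 0⟩, ⟨.cap, 1⟩] [] := by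
  have key : ∀ {H : Type} [Group H] {x : H × H} {R b : List (H × H)} {ps : List H},
      Path [⟨.cup, 1⟩, ⟨.cross c, 0⟩, ⟨.cap, 1⟩, ⟨.cup, 1⟩, ⟨.cross (!c), 0⟩, ⟨.cap, 1⟩]
        (x :: R) ps b ↔ ps = [(loopStrand c x).1, (loopStrand c x).2,
          (loopStrand (!c) (afterLoop c x)).1, (loopStrand (!c) (afterLoop c x)).2] ∧
          b = x :: R := by
    intro H _ x R b ps
    simp [path_cons_loop, afterLoop_afterLoop_not, path_nil]
  apply Equivalent.nil
  · rintro H _ (_ | ⟨x, R⟩) b ps h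
    · simpa using h.le_length
    exact (key.1 h).2
  · rintro H _ (_ | ⟨x, R⟩) hk
    · simp at hk
    exact ⟨_, key.2 ⟨rfl, rfl⟩⟩
  · rintro H _ (_ | ⟨x, R⟩) b ps ps' h h'
    · simpa using h.le_length
    exact (key.1 h).1.trans (key.1 h').1.symm

end Crossings

/-- Events at disjoint places can be exchanged. -/
theorem equivalent_exchange (e f : Event) (d : ℕ) :
    Equivalent 0 [⟨e, 0⟩, ⟨f, e.cod + d⟩] [⟨f, e.dom + d⟩, ⟨e, 0⟩] := by
  have h₁ : ∀ {H : Type} [Group H] {a b : List (H × H)} {ps : List H},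
      Path [⟨e, 0⟩, ⟨f, e.cod + d⟩] a ps b ↔ ∃ M M' R R' qs rs, a = M ++ R ∧ b = M' ++ R' ∧
        ps = qs ++ rs ∧ e.Rel M qs M' ∧ Step f d R rs R' := by
    intro H _ a b ps
    constructor
    · rintro ⟨qs, c, rs, rfl, ⟨M, M', R, rfl, rfl, h⟩, h'⟩
      rw [path_singleton] at h'
      simp only [← h.length_eq.2, step_append] at h'
      obtain ⟨R', rfl, h'⟩ := h'
      exact ⟨M, M', R, R', qs, rs, rfl, rfl, rfl, h, h'⟩
    · rintro ⟨M, M', R, R', qs, rs, rfl, rfl, rfl, h, h'⟩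
      refine ⟨qs, M' ++ R, rs, rfl, ⟨M, M', R, rfl, rfl, h⟩, ?_⟩
      rw [path_singleton, ← h.length_eq.2, step_append]
      exact ⟨R', rfl, h'⟩
  have h₂ : ∀ {H : Type} [Group H] {a b : List (H × H)} {ps : List H},
      Path [⟨f, e.dom + d⟩, ⟨e, 0⟩] a ps b ↔ ∃ M M' R R' qs rs, a = M ++ R ∧ b = M' ++ R' ∧
        ps = rs ++ qs ∧ e.Rel M qs M' ∧ Step f d R rs R' := by
    intro H _ a b ps
    constructor
    · rintro ⟨rs, c, qs, rfl, h, h'⟩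
      have hl := h.length_eq.1
      dsimp only at h hl
      rw [← List.take_append_drop e.dom a] at h
      generalize hM : a.take e.dom = M at h
      have hM' : M.length = e.dom := by rw [← hM, List.length_take]; omega
      rw [← hM', step_append] at h
      obtain ⟨R', rfl, h⟩ := h
      rw [path_singleton] at h'
      obtain ⟨N, M', S, h1, rfl, h'⟩ := h'
      obtain ⟨rfl, rfl⟩ := List.append_inj h1 (by rw [hM', h'.length_eq.1])
      exact ⟨M, M', _, R', qs, rs, by
        have := List.take_append_drop e.dom a
        rw [hM, ← hM'] at this
        exact this.symm, rfl, rfl, h', h⟩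
    · rintro ⟨M, M', R, R', qs, rs, rfl, rfl, rfl, h, h'⟩
      refine ⟨rs, M ++ R', qs, rfl, ?_, path_singleton.2 ⟨M, M', R', rfl, rfl, h⟩⟩
      rw [← h.length_eq.1, step_append]
      exact ⟨R', rfl, h'⟩
  have h₃ : ∀ {H : Type} [Group H] {M N M' N' R S R' S' : List (H × H)} {qs qs' rs rs' : List H},
      M ++ R = N ++ S → M' ++ R' = N' ++ S' → e.Rel M qs M' → e.Rel N qs' N' →
      Step f d R rs R' → Step f d S rs' S' → qs = qs' ∧ rs = rs' := by
    intro H _ M N M' N' R S R' S' qs qs' rs rs' ha hb h h' k k'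
    obtain ⟨rfl, rfl⟩ := List.append_inj ha (by rw [h.length_eq.1, h'.length_eq.1])
    obtain ⟨rfl, rfl⟩ := List.append_inj hb (by rw [h.length_eq.2, h'.length_eq.2])
    exact ⟨h.params_unique h', k.params_unique k'⟩
  refine ⟨?_, ?_, ?_⟩
  · intro H _ a b _
    simp only [h₁, h₂]
    constructor
    · rintro ⟨ps, M, M', R, R', qs, rs, h1, h2, -, h⟩
      exact ⟨_, M, M', R, R', qs, rs, h1, h2, rfl, h⟩
    · rintro ⟨ps, M, M', R, R', qs, rs, h1, h2, -, h⟩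
      exact ⟨_, M, M', R, R', qs, rs, h1, h2, rfl, h⟩
  · intro H _ a b ps ps' h h'
    rw [h₁] at h h'
    obtain ⟨M, M', R, R', qs, rs, rfl, rfl, rfl, h, k⟩ := h
    obtain ⟨N, N', S, S', qs', rs', ha, hb, rfl, h', k'⟩ := h'
    obtain ⟨rfl, rfl⟩ := h₃ ha hb h h' k k'
    rfl
  · intro H _ a b ps ps' h h'
    rw [h₂] at h h'
    obtain ⟨M, M', R, R', qs, rs, rfl, rfl, rfl, h, k⟩ := h
    obtain ⟨N, N', S, S', qs', rs', ha, hb, rfl, h', k'⟩ := h'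
    obtain ⟨rfl, rfl⟩ := h₃ ha hb h h' k k'
    rfl

/-- The two sides of a local move impose the same condition on the labels at their bottom and top
levels. -/
theorem LocalMove.equivalent {p q : List Slice} (h : LocalMove p q) {n : ℕ} {v : List Slice}
    (hp : Fits n (p ++ v)) : Equivalent n p q := by
  have mono : ∀ {k : ℕ} {p q : List Slice}, Equivalent k p q → k ≤ n → Equivalent n p q :=
    fun h hk => ⟨fun a b hn => h.exists_iff a b (hk.trans hn), h.unique_left, h.unique_right⟩
  cases h with
  | exchange e f i d =>
    refine mono (k := i) ?_ ((Nat.le_add_right _ _).trans hp.1)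
    simpa [Slice.shift, add_assoc] using (equivalent_exchange e f d).shift i
  | zigzag_left i =>
    have h := hp.2.1
    simp only [Slice.next, Event.dom, Event.cod] at h
    exact mono (equivalent_zigzag_left.shift i) (by omega)
  | zigzag_right i =>
    exact mono (equivalent_zigzag_right.shift i) hp.1
  | rotate_split_left i =>
    exact mono (equivalent_rotate_split_left.shift i) ((Nat.le_add_right _ _).trans hp.1)
  | rotate_split_right i =>
    exact mono (equivalent_rotate_split_right.shift i) ((Nat.le_succ i).trans hp.1)
  | rotate_merge_left i =>
    exact mono (equivalent_rotate_merge_left.shift i)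
      ((Nat.le_succ i).trans ((Nat.le_add_right _ _).trans hp.1))
  | rotate_merge_right i =>
    exact mono (equivalent_rotate_merge_right.shift i) ((Nat.le_add_right _ _).trans hp.1)
  | rotate_cross_cup c i =>
    exact mono ((equivalent_rotate_cross_cup c).shift i) ((Nat.le_succ i).trans hp.1)
  | rotate_cross_cap c i =>
    exact mono ((equivalent_rotate_cross_cap c).shift i) ((Nat.le_add_right _ _).trans hp.1)
  | cancelLoops c i =>
    exact mono ((equivalent_cancelLoops c).shift i) hp.1
  | reidemeisterTwo c i =>
    exact mono ((equivalent_cross_cross c).shift i) hp.1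
  | reidemeisterThree a b c i h =>
    exact mono ((equivalent_reidemeisterThree a b c h).shift i) ((Nat.le_add_right _ _).trans hp.1)
  | slideVertex c i =>
    exact mono ((equivalent_slideVertex c).shift i)
      ((Nat.le_succ i).trans ((Nat.le_add_right _ _).trans hp.1))
  | ih i =>
    exact mono (equivalent_ih.shift i) ((Nat.le_add_right _ _).trans hp.1)

/-! ### Groups that carry a universal labelling -/

theorem Path.length_eq {H : Type} [Group H] {w : List Slice} {a b : List (H × H)} {ps : List H}
    (h : Path w a ps b) : b.length = w.foldl Slice.next a.length := by
  induction w generalizing a ps with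
  | nil => simp [h.2]
  | cons s w ih =>
    obtain ⟨_, c, _, -, h, h'⟩ := h
    rw [ih h', h.length_eq.2, List.foldl_cons, Slice.next]

/-- The group `P` is generated, in a universal way, by the labels `ps` of a closed stack `w` and
`k` further elements `d`: homomorphisms from `P` to a group `H` correspond to the labellings of `w`
in `H` together with `k` elements of `H`. -/
structure IsUniversal (w : List Slice) (k : ℕ) {P : Type} [Group P] (ps : List P)
    (d : Fin k → P) : Prop where
  path : Path w [] ps []
  exists_hom : ∀ {H : Type} [Group H] (qs : List H) (e : Fin k → H), Path w [] qs [] →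
    ∃ f : P →* H, ps.map f = qs ∧ ∀ i, f (d i) = e i
  hom_ext : ∀ {H : Type} [Group H] (f g : P →* H), ps.map f = ps.map g →
    (∀ i, f (d i) = g (d i)) → f = g

theorem IsUniversal.nonempty_mulEquiv {w : List Slice} {k : ℕ} {P Q : Type} [Group P] [Group Q]
    {ps : List P} {d : Fin k → P} {qs : List Q} {e : Fin k → Q} (h : IsUniversal w k ps d)
    (h' : IsUniversal w k qs e) : Nonempty (P ≃* Q) := by
  obtain ⟨f, hf, hf'⟩ := h.exists_hom qs e h'.path
  obtain ⟨g, hg, hg'⟩ := h'.exists_hom ps d h.path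
  refine ⟨MonoidHom.toMulEquiv f g (h.hom_ext _ _ ?_ ?_) (h'.hom_ext _ _ ?_ ?_)⟩
  · simp only [MonoidHom.coe_comp, ← List.map_map, hf, hg, MonoidHom.coe_id, List.map_id]
  · simp [hf', hg']
  · simp only [MonoidHom.coe_comp, ← List.map_map, hf, hg, MonoidHom.coe_id, List.map_id]
  · simp [hf', hg']

/-- A part of a stack can be replaced by an equivalent one without changing the universal group. -/
theorem IsUniversal.replace {u p q v : List Slice} {k : ℕ} {P : Type} [Group P]
    {ps : List P} {d : Fin k → P} (h : IsUniversal (u ++ p ++ v) k ps d)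
    (hE : ∀ n, Fits n (p ++ v) → Equivalent n p q) :
    ∃ qs : List P, IsUniversal (u ++ q ++ v) k qs d := by
  have hpath := h.path
  rw [List.append_assoc, path_append] at hpath
  obtain ⟨pu, c₁, _, rfl, hu, h2⟩ := hpath
  have hn := hE _ h2.fits
  obtain ⟨pp, c₂, pv, rfl, hp, hv⟩ := path_append.1 h2
  obtain ⟨pq, hq⟩ := (hn.exists_iff c₁ c₂ le_rfl).1 ⟨pp, hp⟩
  refine ⟨pu ++ (pq ++ pv), ?_, ?_, ?_⟩
  · rw [List.append_assoc]
    exact hu.append (hq.append hv)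
  · intro H _ qs e hqs
    rw [List.append_assoc, path_append] at hqs
    obtain ⟨ru, c₁', _, rfl, hu', h3⟩ := hqs
    obtain ⟨rq, c₂', rv, rfl, hq', hv'⟩ := path_append.1 h3
    have hl : c₁.length ≤ c₁'.length := by rw [hu.length_eq, hu'.length_eq]; rfl
    obtain ⟨rp, hp'⟩ := (hn.exists_iff c₁' c₂' hl).2 ⟨rq, hq'⟩
    obtain ⟨f, hf, hf'⟩ := h.exists_hom (ru ++ (rp ++ rv)) e (by
      rw [List.append_assoc]
      exact hu'.append (hp'.append hv'))
    refine ⟨f, ?_, hf'⟩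
    simp only [List.map_append] at hf ⊢
    obtain ⟨e1, hf⟩ := List.append_inj hf (by simp [hu.births_eq, hu'.births_eq])
    obtain ⟨e2, e3⟩ := List.append_inj hf (by simp [hp.births_eq, hp'.births_eq])
    have e4 : c₁.map (Prod.map f f) = c₁' := (e1 ▸ hu.map f).top_unique hu'
    have e5 : c₂.map (Prod.map f f) = c₂' := by
      refine (hp.map f).top_unique ?_
      rwa [e2, e4]
    have e6 := hq.map f
    rw [e4, e5] at e6
    rw [e1, e3, hn.unique_right _ _ _ _ e6 hq']
  · intro H _ f g hfg hd
    refine h.hom_ext f g ?_ hd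
    simp only [List.map_append] at hfg ⊢
    obtain ⟨h1, hfg⟩ := List.append_inj hfg (by simp)
    obtain ⟨h2, h3⟩ := List.append_inj hfg (by simp)
    have e1 : c₁.map (Prod.map f f) = c₁.map (Prod.map g g) := by
      refine (hu.map f).top_unique ?_
      rw [h1]
      exact hu.map g
    have e2 : c₂.map (Prod.map f f) = c₂.map (Prod.map g g) := by
      refine (hq.map f).top_unique ?_
      rw [h2, e1]
      exact hq.map g
    have e3 : pp.map f = pp.map g := by
      refine hn.unique_left _ _ _ _ (hp.map f) ?_
      rw [e1, e2]
      exact hp.map g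
    rw [h1, h3, e3]

/-! ### The equations of a slice -/

section Bridge

variable {H : Type}

/-- The labels `a j σ` for `j < n`, as a list of pairs. -/
def level (n : ℕ) (a : ℕ → Side → H) : List (H × H) :=
  (List.range n).map fun j => (a j .left, a j .right)

@[simp] theorem level_zero (a : ℕ → Side → H) : level 0 a = [] := rfl

theorem level_succ (n : ℕ) (a : ℕ → Side → H) :
    level (n + 1) a = (a 0 .left, a 0 .right) :: level n (fun j => a (j + 1)) := by
  simp [level, List.range_succ_eq_map]

theorem level_congr {n : ℕ} {a b : ℕ → Side → H} :
    level n a = level n b ↔ ∀ j < n, ∀ σ, a j σ = b j σ := by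
  simp only [level, List.map_inj_left, List.mem_range, Prod.mk.injEq]
  refine forall₂_congr fun j _ => ⟨?_, fun h => ⟨h _, h _⟩⟩
  rintro ⟨h₁, h₂⟩ (_ | _)
  exacts [h₁, h₂]

theorem level_add (m n : ℕ) (a : ℕ → Side → H) :
    level (m + n) a = level m a ++ level n (fun j => a (m + j)) := by
  simp [level, List.range_add]

variable [Group H]

/-- The equations of a slice with a ribbon to the left of its event: the labels of that ribbon do
not change, and the other equations are those of the slice without it. -/
theorem equation_succ {n : ℕ} {a b : ℕ → Side → H} {e : Event} {i : ℕ} {p q : H} :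
    Slice.Equation (n + 1) a b ⟨e, i + 1⟩ p q ↔ (∃ σ, p = b 0 σ ∧ q = a 0 σ) ∨
      Slice.Equation n (fun j => a (j + 1)) (fun j => b (j + 1)) ⟨e, i⟩ p q := by
  constructor
  · intro h
    generalize hs : (⟨e, i + 1⟩ : Slice) = s at h
    cases h with
    | left_of e' i' j σ h =>
      cases hs
      rcases j with _ | j
      · exact .inl ⟨σ, rfl, rfl⟩
      · exact .inr (Slice.Equation.left_of (a := fun j => a (j + 1)) (b := fun j => b (j + 1))
          e i j σ (by omega))
    | right_of e' i' d σ h =>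
      cases hs
      right
      have := Slice.Equation.right_of (n := n) (a := fun j => a (j + 1))
        (b := fun j => b (j + 1)) e i d σ (by omega)
      convert this using 2 <;> omega
    | cup_outer i' => cases hs; exact .inr (.cup_outer i)
    | cup_inner i' => cases hs; exact .inr (.cup_inner i)
    | cap_outer i' => cases hs; exact .inr (.cap_outer i)
    | cap_inner i' => cases hs; exact .inr (.cap_inner i)
    | split_left i' => cases hs; exact .inr (.split_left i)
    | split_middle i' => cases hs; exact .inr (.split_middle i)
    | split_right i' => cases hs; exact .inr (.split_right i)
    | merge_left i' => cases hs; exact .inr (.merge_left i)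
    | merge_middle i' => cases hs; exact .inr (.merge_middle i)
    | merge_right i' => cases hs; exact .inr (.merge_right i)
    | leftOver_over i' σ => cases hs; exact .inr (.leftOver_over i σ)
    | leftOver_under i' σ => cases hs; exact .inr (.leftOver_under i σ)
    | rightOver_over i' σ => cases hs; exact .inr (.rightOver_over i σ)
    | rightOver_under i' σ => cases hs; exact .inr (.rightOver_under i σ)
  · rintro (⟨σ, rfl, rfl⟩ | h)
    · exact .left_of e (i + 1) 0 σ (by omega)
    · generalize hs : (⟨e, i⟩ : Slice) = s at h
      cases h with
      | left_of e' i' j σ h => cases hs; exact .left_of e (i + 1) (j + 1) σ (by omega)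
      | right_of e' i' d σ h =>
        cases hs
        have := Slice.Equation.right_of (n := n + 1) (a := a) (b := b) e (i + 1) d σ (by omega)
        convert this using 2 <;> omega
      | cup_outer i' => cases hs; exact .cup_outer (i + 1)
      | cup_inner i' => cases hs; exact .cup_inner (i + 1)
      | cap_outer i' => cases hs; exact .cap_outer (i + 1)
      | cap_inner i' => cases hs; exact .cap_inner (i + 1)
      | split_left i' => cases hs; exact .split_left (i + 1)
      | split_middle i' => cases hs; exact .split_middle (i + 1)
      | split_right i' => cases hs; exact .split_right (i + 1)
      | merge_left i' => cases hs; exact .merge_left (i + 1)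
      | merge_middle i' => cases hs; exact .merge_middle (i + 1)
      | merge_right i' => cases hs; exact .merge_right (i + 1)
      | leftOver_over i' σ => cases hs; exact .leftOver_over (i + 1) σ
      | leftOver_under i' σ => cases hs; exact .leftOver_under (i + 1) σ
      | rightOver_over i' σ => cases hs; exact .rightOver_over (i + 1) σ
      | rightOver_under i' σ => cases hs; exact .rightOver_under (i + 1) σ

/-- The equations imposed by the event of a slice itself, when there are no ribbons to its left. -/
def Event.Equations (a b : ℕ → Side → H) : Event → Prop
  | .cup => b 0 .left = b 1 .right ∧ b 0 .right = b 1 .left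
  | .cap => a 0 .left = a 1 .right ∧ a 0 .right = a 1 .left
  | .split => b 0 .left = a 0 .left ∧ b 0 .right = b 1 .left ∧ b 1 .right = a 0 .right
  | .merge => b 0 .left = a 0 .left ∧ a 0 .right = a 1 .left ∧ b 0 .right = a 1 .right
  | .cross true => ∀ σ, b 1 σ = a 0 σ ∧ b 0 σ = a 1 σ * (a 0 .right)⁻¹ * a 0 .left
  | .cross false => ∀ σ, b 0 σ = a 1 σ ∧ b 1 σ = a 0 σ * (a 1 .left)⁻¹ * a 1 .right

theorem equation_zero {n : ℕ} {a b : ℕ → Side → H} {e : Event} :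
    (∀ p q, Slice.Equation n a b ⟨e, 0⟩ p q → p = q) ↔
      e.Equations a b ∧ ∀ d σ, e.dom + d < n → b (e.cod + d) σ = a (e.dom + d) σ := by
  constructor
  · intro h
    refine ⟨?_, fun d σ hd => ?_⟩
    · rcases e with _ | _ | (_ | _) | _ | _
      · exact ⟨h _ _ (.cup_outer 0), h _ _ (.cup_inner 0)⟩
      · exact ⟨h _ _ (.cap_outer 0), h _ _ (.cap_inner 0)⟩
      · exact fun σ => ⟨h _ _ (.rightOver_over 0 σ), h _ _ (.rightOver_under 0 σ)⟩
      · exact fun σ => ⟨h _ _ (.leftOver_over 0 σ), h _ _ (.leftOver_under 0 σ)⟩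
      · exact ⟨h _ _ (.split_left 0), h _ _ (.split_middle 0), h _ _ (.split_right 0)⟩
      · exact ⟨h _ _ (.merge_left 0), h _ _ (.merge_middle 0), h _ _ (.merge_right 0)⟩
    · simpa using h _ _ (.right_of e 0 d σ (by omega))
  · rintro ⟨h, h'⟩ p q hpq
    generalize hs : (⟨e, 0⟩ : Slice) = s at hpq
    cases hpq with
    | left_of e' i' j σ h => cases hs; omega
    | right_of e' i' d σ hd => cases hs; simpa using h' d σ (by omega)
    | cup_outer i' => cases hs; exact h.1
    | cup_inner i' => cases hs; exact h.2
    | cap_outer i' => cases hs; exact h.1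
    | cap_inner i' => cases hs; exact h.2
    | split_left i' => cases hs; exact h.1
    | split_middle i' => cases hs; exact h.2.1
    | split_right i' => cases hs; exact h.2.2
    | merge_left i' => cases hs; exact h.1
    | merge_middle i' => cases hs; exact h.2.1
    | merge_right i' => cases hs; exact h.2.2
    | leftOver_over i' σ => cases hs; exact (h σ).1
    | leftOver_under i' σ => cases hs; exact (h σ).2
    | rightOver_over i' σ => cases hs; exact (h σ).1
    | rightOver_under i' σ => cases hs; exact (h σ).2

theorem event_rel_level {e : Event} {a b : ℕ → Side → H} :
    (∃ ps, e.Rel (level e.dom a) ps (level e.cod b)) ↔ e.Equations a b := by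
  have hσ : ∀ {p : Side → Prop}, (∀ σ, p σ) ↔ p .left ∧ p .right :=
    ⟨fun h => ⟨h _, h _⟩, fun h σ => by cases σ; exacts [h.1, h.2]⟩
  rcases e with _ | _ | (_ | _) | _ | _ <;>
    simp [Event.Rel, Event.Equations, level_succ, Event.dom, Event.cod, hσ] <;> grind

theorem level_next {e : Event} {r : ℕ} : Slice.next (e.dom + r) ⟨e, 0⟩ = e.cod + r := by
  simp only [Slice.next]
  omega

/-- The equations of a slice say that the labels of its two levels satisfy `Step`. -/
theorem step_level {n : ℕ} {a b : ℕ → Side → H} {s : Slice} (hs : s.pos + s.event.dom ≤ n) :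
    (∃ ps, Step s.event s.pos (level n a) ps (level (s.next n) b)) ↔
      ∀ p q, s.Equation n a b p q → p = q := by
  obtain ⟨e, i⟩ := s
  dsimp only at hs ⊢
  induction i generalizing n a b with
  | zero =>
    obtain ⟨r, rfl⟩ := Nat.exists_eq_add_of_le (show e.dom ≤ n by omega)
    rw [equation_zero, level_next, level_add, level_add, ← event_rel_level]
    have : (∀ d σ, e.dom + d < e.dom + r → b (e.cod + d) σ = a (e.dom + d) σ) ↔
        level r (fun j => b (e.cod + j)) = level r (fun j => a (e.dom + j)) := by
      rw [level_congr]
      exact ⟨fun h d hd σ => h d σ (by omega), fun h d σ hd => h d (by omega) σ⟩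
    rw [this]
    constructor
    · rintro ⟨ps, M, M', R, h1, h2, h⟩
      obtain ⟨rfl, rfl⟩ := List.append_inj h1 (by simp [level, h.length_eq])
      obtain ⟨rfl, h3⟩ := List.append_inj h2 (by simp [level, h.length_eq])
      exact ⟨⟨ps, h⟩, h3⟩
    · rintro ⟨⟨ps, h⟩, h'⟩
      exact ⟨ps, _, _, _, rfl, by rw [h'], h⟩
  | succ i ih =>
    obtain ⟨n, rfl⟩ := Nat.exists_eq_add_of_le (show 1 ≤ n by omega)
    have hnext : Slice.next (1 + n) ⟨e, i + 1⟩ = Slice.next n ⟨e, i⟩ + 1 := by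
      simp only [Slice.next]
      omega
    rw [hnext, Nat.add_comm 1 n, level_succ, level_succ]
    simp only [step_succ_cons, equation_succ, List.cons.injEq, Prod.mk.injEq]
    have := ih (n := n) (a := fun j => a (j + 1)) (b := fun j => b (j + 1)) (by omega)
    constructor
    · rintro ⟨ps, b', ⟨⟨h1, h2⟩, rfl⟩, h⟩ p q (⟨σ, rfl, rfl⟩ | h')
      · cases σ
        exacts [h1, h2]
      · exact this.1 ⟨ps, h⟩ p q h'
    · intro h
      obtain ⟨ps, h'⟩ := this.2 fun p q h' => h p q (.inr h')
      exact ⟨ps, _, ⟨⟨h _ _ (.inl ⟨_, rfl, rfl⟩), h _ _ (.inl ⟨_, rfl, rfl⟩)⟩, rfl⟩, h'⟩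

end Bridge

/-! ### The fundamental heap carries a universal labelling -/

section Levels

variable {H K : Type} [Group H] [Group K]

/-- `Via w st ps` says that the levels `st 0, st 1, …` form a labelling of `w` in which the labels
`ps` begin at minima and vertices. -/
def Via : List Slice → (ℕ → List (H × H)) → List H → Prop
  | [], _, ps => ps = []
  | s :: w, st, ps => ∃ qs rs, ps = qs ++ rs ∧ Step s.event s.pos (st 0) qs (st 1) ∧
      Via w (fun t => st (t + 1)) rs

theorem Via.path {w : List Slice} {st : ℕ → List (H × H)} {ps : List H} (h : Via w st ps) :
    Path w (st 0) ps (st w.length) := by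
  induction w generalizing st ps with
  | nil => exact ⟨h, rfl⟩
  | cons s w ih =>
    obtain ⟨qs, rs, rfl, h, h'⟩ := h
    exact ⟨qs, _, rs, rfl, h, ih h'⟩

theorem Path.exists_via {w : List Slice} {a b : List (H × H)} {ps : List H} (h : Path w a ps b) :
    ∃ st, st 0 = a ∧ Via w st ps := by
  induction w generalizing a ps with
  | nil => exact ⟨fun _ => a, rfl, h.1⟩
  | cons s w ih =>
    obtain ⟨qs, c, rs, rfl, h, h'⟩ := h
    obtain ⟨st, rfl, hst⟩ := ih h'
    exact ⟨fun t => Nat.casesOn t a st, rfl, qs, rs, rfl, h, hst⟩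

theorem exists_via_iff {w : List Slice} {st : ℕ → List (H × H)} :
    (∃ ps, Via w st ps) ↔
      ∀ t s, w[t]? = some s → ∃ qs, Step s.event s.pos (st t) qs (st (t + 1)) := by
  induction w generalizing st with
  | nil => simp [Via]
  | cons s w ih =>
    constructor
    · rintro ⟨_, qs, rs, rfl, h, h'⟩ (_ | t) s' hs
      · simp only [List.getElem?_cons_zero, Option.some.injEq] at hs
        subst hs
        exact ⟨qs, h⟩
      · exact ih.1 ⟨rs, h'⟩ t s' (by simpa using hs)
    · intro h
      obtain ⟨qs, h0⟩ := h 0 s (by simp)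
      obtain ⟨rs, h1⟩ := ih.2 fun t s' hs => h (t + 1) s' (by simpa using hs)
      exact ⟨_, qs, rs, rfl, h0, h1⟩

theorem Via.params_unique {w : List Slice} {st st' : ℕ → List (H × H)} {ps ps' : List H}
    (h : Via w st ps) (h' : Via w st' ps') (hst : ∀ t ≤ w.length, st t = st' t) : ps = ps' := by
  induction w generalizing st st' ps ps' with
  | nil => exact Eq.trans h (Eq.symm h')
  | cons s w ih =>
    obtain ⟨qs, rs, rfl, h1, h2⟩ := h
    obtain ⟨qs', rs', rfl, h1', h2'⟩ := h'
    rw [← hst 0 (by simp), ← hst 1 (by simp)] at h1'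
    rw [h1.params_unique h1', ih h2 h2' fun t ht => hst (t + 1) (by simpa using ht)]

theorem Via.levels_unique {w : List Slice} {st st' : ℕ → List (H × H)} {ps : List H}
    (h : Via w st ps) (h' : Via w st' ps) (h0 : st 0 = st' 0) :
    ∀ t ≤ w.length, st t = st' t := by
  induction w generalizing st st' ps with
  | nil =>
    intro t ht
    obtain rfl : t = 0 := by simpa using ht
    exact h0
  | cons s w ih =>
    obtain ⟨qs, rs, rfl, h1, h2⟩ := h
    obtain ⟨qs', rs', h3, h1', h2'⟩ := h'
    obtain ⟨rfl, rfl⟩ := List.append_inj h3 (by rw [h1.births_eq, h1'.births_eq])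
    rw [← h0] at h1'
    rintro (_ | t) ht
    · exact h0
    · exact ih h2 h2' (h1.top_unique h1') t (by simpa using ht)

theorem Via.map {w : List Slice} {st : ℕ → List (H × H)} {ps : List H} (f : H →* K)
    (h : Via w st ps) : Via w (fun t => (st t).map (Prod.map f f)) (ps.map f) := by
  induction w generalizing st ps with
  | nil =>
    obtain rfl : ps = [] := h
    rfl
  | cons s w ih =>
    obtain ⟨qs, rs, rfl, h, h'⟩ := h
    exact ⟨_, _, List.map_append, h.map f, ih h'⟩

theorem Via.length_eq {w : List Slice} {st : ℕ → List (H × H)} {ps : List H} (h : Via w st ps)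
    {t : ℕ} (ht : t ≤ w.length) :
    (st t).length = (w.take t).foldl Slice.next (st 0).length := by
  induction w generalizing st ps t with
  | nil =>
    obtain rfl : t = 0 := by simpa using ht
    rfl
  | cons s w ih =>
    obtain ⟨qs, rs, rfl, h, h'⟩ := h
    rcases t with _ | t
    · rfl
    · rw [List.take_succ_cons, List.foldl_cons, ih h' (by simpa using ht)]
      rw [h.length_eq.2, Slice.next]

theorem level_map (f : H →* K) (n : ℕ) (a : ℕ → Side → H) :
    (level n a).map (Prod.map f f) = level n fun j σ => f (a j σ) := by
  simp [level]

/-- The equations between images of labels under a homomorphism are the images of the equations. -/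
theorem equation_map_iff (f : H →* K) {n : ℕ} {a b : ℕ → Side → H} {s : Slice} {p q : K} :
    s.Equation n (fun j σ => f (a j σ)) (fun j σ => f (b j σ)) p q ↔
      ∃ p' q', f p' = p ∧ f q' = q ∧ s.Equation n a b p' q' := by
  constructor
  · intro h
    cases h with
    | left_of e i j σ h => exact ⟨_, _, rfl, rfl, .left_of e i j σ h⟩
    | right_of e i d σ h => exact ⟨_, _, rfl, rfl, .right_of e i d σ h⟩
    | cup_outer i => exact ⟨_, _, rfl, rfl, .cup_outer i⟩
    | cup_inner i => exact ⟨_, _, rfl, rfl, .cup_inner i⟩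
    | cap_outer i => exact ⟨_, _, rfl, rfl, .cap_outer i⟩
    | cap_inner i => exact ⟨_, _, rfl, rfl, .cap_inner i⟩
    | split_left i => exact ⟨_, _, rfl, rfl, .split_left i⟩
    | split_middle i => exact ⟨_, _, rfl, rfl, .split_middle i⟩
    | split_right i => exact ⟨_, _, rfl, rfl, .split_right i⟩
    | merge_left i => exact ⟨_, _, rfl, rfl, .merge_left i⟩
    | merge_middle i => exact ⟨_, _, rfl, rfl, .merge_middle i⟩
    | merge_right i => exact ⟨_, _, rfl, rfl, .merge_right i⟩
    | leftOver_over i σ => exact ⟨_, _, rfl, rfl, .leftOver_over i σ⟩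
    | leftOver_under i σ => exact ⟨_, _, rfl, by simp, .leftOver_under i σ⟩
    | rightOver_over i σ => exact ⟨_, _, rfl, rfl, .rightOver_over i σ⟩
    | rightOver_under i σ => exact ⟨_, _, rfl, by simp, .rightOver_under i σ⟩
  · rintro ⟨p', q', rfl, rfl, h⟩
    cases h with
    | left_of e i j σ h => exact .left_of e i j σ h
    | right_of e i d σ h =>
      exact Slice.Equation.right_of (a := fun j σ => f (a j σ)) (b := fun j σ => f (b j σ))
        e i d σ h
    | cup_outer i => exact .cup_outer i
    | cup_inner i => exact .cup_inner i
    | cap_outer i => exact .cap_outer i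
    | cap_inner i => exact .cap_inner i
    | split_left i => exact .split_left i
    | split_middle i => exact .split_middle i
    | split_right i => exact .split_right i
    | merge_left i => exact .merge_left i
    | merge_middle i => exact .merge_middle i
    | merge_right i => exact .merge_right i
    | leftOver_over i σ => exact .leftOver_over i σ
    | leftOver_under i σ => simpa only [map_mul, map_inv] using .leftOver_under i σ
    | rightOver_over i σ => exact .rightOver_over i σ
    | rightOver_under i σ => simpa only [map_mul, map_inv] using .rightOver_under i σ

end Levels

theorem Fits.le_width {n t : ℕ} {w : List Slice} {s : Slice} (h : Fits n w)
    (hs : w[t]? = some s) : s.pos + s.event.dom ≤ (w.take t).foldl Slice.next n := by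
  induction w generalizing n t with
  | nil => simp at hs
  | cons s' w ih =>
    rcases t with _ | t
    · simp only [List.getElem?_cons_zero, Option.some.injEq] at hs
      subst hs
      exact h.1
    · exact ih h.2 (by simpa using hs)

theorem Fits.foldl_eq_zero {n : ℕ} {w : List Slice} (h : Fits n w) :
    w.foldl Slice.next n = 0 := by
  induction w generalizing n with
  | nil => exact h
  | cons s w ih => exact ih h.2

/-- The label on one side of a ribbon. -/
def Side.get {H : Type} : Side → H × H → H
  | .left, x => x.1
  | .right, x => x.2

namespace Diagram

variable (D : Diagram)

theorem width_succ {D : Diagram} {t : ℕ} {s : Slice} (hs : D.word[t]? = some s) :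
    D.width (t + 1) = s.next (D.width t) := by
  rw [width, width, List.take_add_one, hs]
  simp

/-- The label of the piece of arc at level `t`, position `j` and side `σ` in the fundamental
heap. -/
noncomputable def label (t j : ℕ) (σ : Side) : D.fundamentalHeap :=
  PresentedGroup.mk D.relators (D.arc t j σ)

theorem exists_via_label :
    ∃ ps, Via D.word (fun t => level (D.width t) (D.label t)) ps := by
  rw [exists_via_iff]
  intro t s hs
  have hle : s.pos + s.event.dom ≤ D.width t := D.fits.le_width hs
  rw [width_succ hs, step_level hle]
  intro p q h
  obtain ⟨p', q', rfl, rfl, h'⟩ := (equation_map_iff (PresentedGroup.mk D.relators)).1 h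
  rw [← mul_inv_eq_one, ← map_inv, ← map_mul]
  exact PresentedGroup.one_of_mem ⟨t, s, p', q', hs, h', rfl⟩

variable {D} in
/-- The homomorphism from the free group on the pieces of arcs that a labelling defines; beyond the
last ribbon of a level both sides are `1` by convention. -/
theorem lift_arc {H : Type} [Group H] {st : ℕ → List (H × H)} {ps : List H}
    (h : Via D.word st ps) (h0 : st 0 = []) (e : Fin D.disks → H) {t : ℕ}
    (ht : t ≤ D.word.length) (j : ℕ) (σ : Side) :
    FreeGroup.lift (Sum.elim (fun x : D.Piece => x.side.get ((st x.level).getD x.pos 1)) e)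
      (D.arc t j σ) = σ.get ((st t).getD j 1) := by
  unfold arc
  split_ifs with hj
  · simp
  · have hl : (st t).length = D.width t := by rw [h.length_eq ht, h0]; rfl
    rw [List.getD_eq_default _ _ (by rw [hl]; by_contra!; exact hj ⟨ht, this⟩), map_one]
    cases σ <;> rfl

theorem level_getD {H : Type} [Group H] (l : List (H × H)) :
    level l.length (fun j σ => σ.get (l.getD j 1)) = l := by
  refine List.ext_getElem (by simp [level]) fun i h₁ h₂ => ?_
  simp [level, Side.get, h₂]

variable {D} in
theorem level_lift_arc {H : Type} [Group H] {st : ℕ → List (H × H)} {ps : List H}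
    (h : Via D.word st ps) (h0 : st 0 = []) (e : Fin D.disks → H) {t : ℕ}
    (ht : t ≤ D.word.length) :
    level (D.width t) (fun j σ =>
      FreeGroup.lift (Sum.elim (fun x : D.Piece => x.side.get ((st x.level).getD x.pos 1)) e)
        (D.arc t j σ)) = st t := by
  have hl : (st t).length = D.width t := by rw [h.length_eq ht, h0]; rfl
  simp only [lift_arc h h0 e ht]
  rw [← hl, level_getD]

/-- Homomorphisms from the fundamental heap of a diagram to a group correspond to the labellings of
the diagram in that group. -/
theorem exists_isUniversal :
    ∃ (ps : List D.fundamentalHeap) (d : Fin D.disks → D.fundamentalHeap),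
      IsUniversal D.word D.disks ps d := by
  obtain ⟨ps, hps⟩ := D.exists_via_label
  refine ⟨ps, fun i => PresentedGroup.of (Sum.inr i), ?_, ?_, ?_⟩
  · have := hps.path
    have hw : D.width D.word.length = 0 := by
      rw [width, List.take_length]
      exact D.fits.foldl_eq_zero
    rw [hw] at this
    exact this
  · intro H _ qs e h
    obtain ⟨st, h0, hst⟩ := h.exists_via
    let φ : D.Gen → H :=
      Sum.elim (fun x : D.Piece => x.side.get ((st x.level).getD x.pos 1)) e
    have hφ : ∀ r ∈ D.relators, FreeGroup.lift φ r = 1 := by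
      rintro r ⟨t, s, p, q, hs, hpq, rfl⟩
      rw [map_mul, map_inv, mul_inv_eq_one]
      have ht : t < D.word.length := (List.getElem?_eq_some_iff.1 hs).1
      obtain ⟨qs', hstep⟩ := exists_via_iff.1 ⟨qs, hst⟩ t s hs
      rw [← level_lift_arc hst h0 e ht.le, ← level_lift_arc hst h0 e ht, width_succ hs] at hstep
      exact (step_level (D.fits.le_width hs)).1 ⟨qs', hstep⟩ _ _
        ((equation_map_iff (FreeGroup.lift φ)).2 ⟨p, q, rfl, rfl, hpq⟩)
    refine ⟨PresentedGroup.toGroup hφ, ?_, fun i => by simp [φ]⟩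
    refine (hps.map (PresentedGroup.toGroup hφ)).params_unique hst fun t ht => ?_
    rw [level_map]
    exact level_lift_arc hst h0 e ht
  · intro H _ f g hfg hd
    refine PresentedGroup.ext fun x => ?_
    rcases x with ⟨t, j, σ, ht, hj⟩ | i
    · have hg := hps.map g
      rw [← hfg] at hg
      have := (hps.map f).levels_unique hg rfl t ht
      rw [level_map, level_map, level_congr] at this
      have := this j hj σ
      rwa [label, arc, dif_pos ⟨ht, hj⟩] at this
    · exact hd i

/-- The fundamental heap does not change under the moves. -/
theorem Move.nonempty_mulEquiv {D E : Diagram} (h : D.Move E) :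
    Nonempty (D.fundamentalHeap ≃* E.fundamentalHeap) := by
  obtain ⟨hk, u, v, p, q, hpq, hD, hE⟩ := h
  obtain ⟨ps, d, hP⟩ := D.exists_isUniversal
  obtain ⟨qs, e, hQ⟩ := E.exists_isUniversal
  rw [hD] at hP
  obtain ⟨ps', hP'⟩ := hP.replace fun n hn => hpq.equivalent hn
  rw [← hE] at hP'
  generalize D.disks = k at hk d hP hP'
  subst hk
  exact hP'.nonempty_mulEquiv hQ

theorem nonempty_mulEquiv_of_surfaceRibbon_eq {D E : Diagram}
    (h : D.surfaceRibbon = E.surfaceRibbon) :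
    Nonempty (D.fundamentalHeap ≃* E.fundamentalHeap) := by
  induction Quot.eqvGen_exact h with
  | rel D E h => exact Move.nonempty_mulEquiv ‹_›
  | refl D => exact ⟨MulEquiv.refl _⟩
  | symm D E _ ih =>
    obtain ⟨f⟩ := ih (Quot.eqvGen_sound ‹_›)
    exact ⟨f.symm⟩
  | trans D E F h₁ h₂ ih₁ ih₂ =>
    obtain ⟨f⟩ := ih₁ (Quot.eqvGen_sound h₁)
    obtain ⟨g⟩ := ih₂ (Quot.eqvGen_sound h₂)
    exact ⟨f.trans g⟩

end Diagram

/-- To compute `h(S)` it is enough to find a universal labelling of one diagram of `S`. -/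
theorem IsUniversal.fundamentalHeapIso {D : Diagram} {P : Type} [Group P] {ps : List P}
    {d : Fin D.disks → P} (h : IsUniversal D.word D.disks ps d) {G : Type*} [Group G]
    (e : P ≃* G) : D.surfaceRibbon.FundamentalHeapIso G := by
  intro E hE
  obtain ⟨f⟩ := Diagram.nonempty_mulEquiv_of_surfaceRibbon_eq hE
  obtain ⟨qs, d', hD⟩ := D.exists_isUniversal
  obtain ⟨g⟩ := hD.nonempty_mulEquiv h
  exact ⟨(f.trans g).trans e⟩

/-! ### The diagram of a presentation -/

section Construction

variable {H : Type} [Group H]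

theorem path_cons_append {e : Event} {k : ℕ} {w : List Slice} (L : List (H × H))
    {a b : List (H × H)} {ps : List H} :
    Path (⟨e, L.length + k⟩ :: w) (L ++ a) ps b ↔
      ∃ qs c rs, ps = qs ++ rs ∧ Step e k a qs c ∧ Path w (L ++ c) rs b := by
  simp only [Path, step_append]
  constructor
  · rintro ⟨qs, _, rs, rfl, ⟨c, rfl, h⟩, h'⟩
    exact ⟨qs, c, rs, rfl, h, h'⟩
  · rintro ⟨qs, c, rs, rfl, h, h'⟩
    exact ⟨qs, _, rs, rfl, ⟨c, rfl, h⟩, h'⟩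

theorem path_cons_append_split {w : List Slice} (L : List (H × H)) {x z : H} {R b : List (H × H)}
    {ps : List H} :
    Path (⟨.split, L.length⟩ :: w) (L ++ (x, z) :: R) ps b ↔
      ∃ y qs, ps = y :: qs ∧ Path w (L ++ (x, y) :: (y, z) :: R) qs b := by
  refine (path_cons_append (k := 0) L).trans ?_
  simp only [step_split]
  constructor
  · rintro ⟨_, _, qs, rfl, ⟨x, y, z, R, rfl, h, rfl⟩, h'⟩
    simp only [List.cons.injEq, Prod.mk.injEq] at h
    obtain ⟨⟨rfl, rfl⟩, rfl⟩ := h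
    exact ⟨y, qs, rfl, h'⟩
  · rintro ⟨y, qs, rfl, h⟩
    exact ⟨[y], _, qs, rfl, ⟨x, y, z, R, rfl, rfl, rfl⟩, h⟩

theorem path_append_merge (L : List (H × H)) {x y : H × H} {R b : List (H × H)}
    {ps : List H} :
    Path [⟨.merge, L.length⟩] (L ++ x :: y :: R) ps b ↔
      ps = [] ∧ y.1 = x.2 ∧ b = L ++ (x.1, y.2) :: R := by
  have hL := path_shift (w := [⟨.merge, 0⟩]) (a := x :: y :: R) (b := b) (ps := ps) L
  simp only [path_cons_merge, path_nil] at hL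
  refine hL.trans ?_
  constructor
  · rintro ⟨_, rfl, h, rfl, rfl⟩
    exact ⟨rfl, h, rfl⟩
  · rintro ⟨rfl, h, rfl⟩
    exact ⟨_, rfl, h, rfl, rfl⟩

theorem path_cons_append_cross {c : Bool} {w : List Slice} (L : List (H × H)) {x y : H × H}
    {R b : List (H × H)} {ps : List H} :
    Path (⟨.cross c, L.length⟩ :: w) (L ++ x :: y :: R) ps b ↔
      Path w (L ++ (crossing c x y).1 :: (crossing c x y).2 :: R) ps b := by
  refine (path_cons_append (k := 0) L).trans ?_
  simp only [step_cross]
  constructor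
  · rintro ⟨_, _, qs, rfl, ⟨rfl, x, y, R, h, rfl⟩, h'⟩
    simp only [List.cons.injEq] at h
    obtain ⟨rfl, rfl, rfl⟩ := h
    exact h'
  · intro h
    exact ⟨[], _, ps, rfl, ⟨rfl, _, _, _, rfl, rfl⟩, h⟩

/-- The labels of the ribbons of a comb: consecutive ribbons have a common boundary arc. -/
def comb (e : H) : H → List H → List (H × H)
  | u, [] => [(u, e)]
  | u, v :: l => (u, v) :: comb e v l

/-- `r` vertices that split the ribbon at position `k` into `r + 1` ribbons. -/
def splits : ℕ → ℕ → List Slice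
  | _, 0 => []
  | k, r + 1 => ⟨.split, k⟩ :: splits (k + 1) r

/-- `r` vertices that merge `r + 1` ribbons into the ribbon at position `k`. -/
def merges : ℕ → ℕ → List Slice
  | _, 0 => []
  | k, r + 1 => merges (k + 1) r ++ [⟨.merge, k⟩]

/-- The labels between the ribbons of a comb are free. -/
theorem path_splits {r : ℕ} {L b : List (H × H)} {u e : H} {ps : List H} :
    Path (splits L.length r) (L ++ [(u, e)]) ps b ↔ ps.length = r ∧ b = L ++ comb e u ps := by
  induction r generalizing L u ps with
  | zero =>
    simp only [splits, path_nil, List.length_eq_zero_iff]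
    refine and_congr_right ?_
    rintro rfl
    rfl
  | succ r ih =>
    rw [splits, path_cons_append_split]
    have h : ∀ y qs, Path (splits (L.length + 1) r) (L ++ [(u, y), (y, e)]) qs b ↔
        qs.length = r ∧ b = L ++ comb e u (y :: qs) := by
      intro y qs
      have := ih (L := L ++ [(u, y)]) (u := y) (ps := qs)
      simpa [comb] using this
    simp only [h]
    constructor
    · rintro ⟨y, qs, rfl, rfl, rfl⟩
      exact ⟨rfl, rfl⟩
    · rintro ⟨hl, rfl⟩
      rcases ps with _ | ⟨y, qs⟩
      · simp at hl
      · exact ⟨y, qs, rfl, by simpa using hl, rfl⟩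

/-- Closing a comb imposes no condition. -/
theorem path_merges {l : List H} {L b : List (H × H)} {u e : H} {ps : List H} :
    Path (merges L.length l.length) (L ++ comb e u l) ps b ↔ ps = [] ∧ b = L ++ [(u, e)] := by
  induction l generalizing L u ps b with
  | nil => exact path_nil
  | cons v l ih =>
    have h : ∀ {c : List (H × H)} {qs : List H},
        Path (merges (L.length + 1) l.length) (L ++ comb e u (v :: l)) qs c ↔
          qs = [] ∧ c = L ++ [(u, v), (v, e)] := by
      intro c qs
      have := ih (L := L ++ [(u, v)]) (u := v) (ps := qs) (b := c)
      simpa [comb] using this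
    rw [List.length_cons, merges, path_append]
    simp only [h]
    constructor
    · rintro ⟨_, _, qs, rfl, ⟨rfl, rfl⟩, h'⟩
      obtain ⟨rfl, -, rfl⟩ := (path_append_merge L).1 h'
      exact ⟨rfl, rfl⟩
    · rintro ⟨rfl, rfl⟩
      exact ⟨[], _, [], rfl, ⟨rfl, rfl⟩, (path_append_merge L).2 ⟨rfl, rfl, rfl⟩⟩

/-- The ribbon at position `k + 1` passes over the `k` ribbons to its left, goes around the ribbon
at position `0`, and returns over the `k` ribbons.  On its way to the left it passes under the
ribbon at position `0` if `c = true`, on its way back if `c = false`. -/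
def circle : ℕ → Bool → List Slice
  | 0, c => [⟨.cross c, 0⟩, ⟨.cross c, 0⟩]
  | k + 1, c => ⟨.cross false, k + 1⟩ :: (circle k c ++ [⟨.cross true, k + 1⟩])

/-- Ribbons passing under a ribbon whose boundary arcs have the same label keep their labels. -/
theorem crossing_false_diag (x : H × H) (t : H) : crossing false x (t, t) = ((t, t), x) := by
  simp [crossing, underRight]

theorem crossing_true_diag (x : H × H) (t : H) : crossing true (t, t) x = (x, (t, t)) := by
  simp [crossing, underLeft]

/-- Going around a ribbon with labels `x` multiplies the label of a ribbon with equal labels by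
`x.1⁻¹ * x.2` or its inverse and changes nothing else. -/
theorem path_circle {c : Bool} {x : H × H} {M R b : List (H × H)} {t : H} {ps : List H} :
    Path (circle M.length c) (x :: (M ++ (t, t) :: R)) ps b ↔ ps = [] ∧
      b = x :: (M ++ (t * cond c (x.1⁻¹ * x.2)⁻¹ (x.1⁻¹ * x.2),
        t * cond c (x.1⁻¹ * x.2)⁻¹ (x.1⁻¹ * x.2)) :: R) := by
  induction M using List.reverseRecOn generalizing R ps b with
  | nil =>
    rw [List.length_nil, circle, List.nil_append, path_cons_cross, path_cons_cross, path_nil]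
    cases c
    · simp only [crossing_false_diag]
      simp [crossing, underRight, mul_assoc]
    · have : (crossing true x (t, t)).1 = (t * (x.2⁻¹ * x.1), t * (x.2⁻¹ * x.1)) := by
        simp [crossing, underLeft, mul_assoc]
      rw [this, crossing_true_diag]
      simp [crossing]
  | append_singleton M y ih =>
    have h1 := path_cons_append_cross (c := false) (w := circle M.length c ++
      [⟨.cross true, M.length + 1⟩]) (x :: M) (x := y) (y := (t, t)) (R := R) (b := b) (ps := ps)
    rw [crossing_false_diag] at h1
    rw [List.length_append, List.length_singleton, circle]
    simp only [List.length_cons, List.cons_append, List.append_assoc, List.nil_append] at h1 ⊢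
    rw [h1, path_append]
    simp only [ih]
    have h2 : ∀ {s : H} {ps : List H}, Path [⟨.cross true, M.length + 1⟩]
        (x :: (M ++ (s, s) :: y :: R)) ps b ↔ ps = [] ∧ b = x :: (M ++ y :: (s, s) :: R) := by
      intro s ps
      have := path_cons_append_cross (c := true) (w := []) (x :: M) (x := (s, s)) (y := y) (R := R)
        (b := b) (ps := ps)
      rw [crossing_true_diag, path_nil] at this
      exact this
    constructor
    · rintro ⟨_, _, qs, rfl, ⟨rfl, rfl⟩, h⟩
      obtain ⟨rfl, rfl⟩ := h2.1 h
      exact ⟨rfl, rfl⟩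
    · rintro ⟨rfl, rfl⟩
      exact ⟨[], _, [], rfl, ⟨rfl, rfl⟩, h2.2 ⟨rfl, rfl⟩⟩

/-- The ribbon at position `n` goes around the `n` ribbons to its left as a word prescribes. -/
def encircle {n : ℕ} (l : List (Fin n × Bool)) : List Slice :=
  l.flatMap fun x => (circle (n - 1 - x.1) (!x.2)).map (Slice.shift x.1)

theorem path_encircle {n : ℕ} {l : List (Fin n × Bool)} {κ : Fin n → H × H} {R b : List (H × H)}
    {t : H} {ps : List H} :
    Path (encircle l) (List.ofFn κ ++ (t, t) :: R) ps b ↔ ps = [] ∧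
      b = List.ofFn κ ++
        (t * FreeGroup.lift (fun i => (κ i).1⁻¹ * (κ i).2) (FreeGroup.mk l),
          t * FreeGroup.lift (fun i => (κ i).1⁻¹ * (κ i).2) (FreeGroup.mk l)) :: R := by
  induction l generalizing t ps b with
  | nil => simp [encircle, path_nil]
  | cons x l ih =>
    obtain ⟨i, ε⟩ := x
    have h : ∀ {b : List (H × H)} {ps : List H},
        Path ((circle (n - 1 - i) (!ε)).map (Slice.shift i)) (List.ofFn κ ++ (t, t) :: R) ps b ↔
          ps = [] ∧ b = List.ofFn κ ++ (t * cond ε ((κ i).1⁻¹ * (κ i).2) ((κ i).1⁻¹ * (κ i).2)⁻¹,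
            t * cond ε ((κ i).1⁻¹ * (κ i).2) ((κ i).1⁻¹ * (κ i).2)⁻¹) :: R := by
      intro b ps
      have hκ : List.ofFn κ = (List.ofFn κ).take i ++ κ i :: (List.ofFn κ).drop (i + 1) := by
        have hi : (i : ℕ) < (List.ofFn κ).length := by simp
        have h := List.drop_eq_getElem_cons hi
        rw [List.getElem_ofFn] at h
        rw [← h, List.take_append_drop]
      have h1 : ((List.ofFn κ).take i).length = i := by simp
      have h2 : ((List.ofFn κ).drop (i + 1)).length = n - 1 - i := by
        simp only [List.length_drop, List.length_ofFn]
        omega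
      generalize (List.ofFn κ).take i = A at hκ h1
      generalize (List.ofFn κ).drop (i + 1) = M at hκ h2
      rw [hκ]
      have := path_shift (w := circle M.length (!ε)) (a := κ i :: (M ++ (t, t) :: R)) (b := b)
        (ps := ps) A
      rw [h1, h2] at this
      simp only [List.append_assoc, List.cons_append]
      rw [this]
      rw [← h2]
      simp only [path_circle]
      cases ε <;> simp [and_comm]
    rw [encircle, List.flatMap_cons, path_append]
    simp only [h]
    have ih' := fun {qs} s => ih (t := s) (b := b) (ps := qs)
    rw [encircle] at ih'
    simp only [FreeGroup.lift_mk, List.map_cons, List.prod_cons] at ih' ⊢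
    simp only [← mul_assoc] at ih' ⊢
    constructor
    · rintro ⟨_, _, qs, rfl, ⟨rfl, rfl⟩, h⟩
      obtain ⟨rfl, rfl⟩ := (ih' _).1 h
      exact ⟨rfl, rfl⟩
    · rintro ⟨rfl, rfl⟩
      exact ⟨[], _, [], rfl, ⟨rfl, rfl⟩, (ih' _).2 ⟨rfl, rfl⟩⟩

/-- Two bands are attached to the ribbon at position `0` in such a way that they cross each other;
one of them is closed, and forces the other one, which is left open, to carry the same label on
both boundary arcs. -/
def handle : List Slice :=
  [⟨.split, 0⟩, ⟨.split, 1⟩, ⟨.split, 2⟩, ⟨.cross false, 1⟩, ⟨.cap, 0⟩]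

/-- The labels of the two ribbons above a handle are determined by the ribbon below it, and the
handle has one free label `x`. -/
theorem path_handle {p q : H} {b : List (H × H)} {ps : List H} :
    Path handle [(p, q)] ps b ↔ ∃ x, ps = [x, x, p] ∧ b = [(p, p), (p, q)] := by
  have h0 := fun {w ps} => path_cons_append_split (w := w) ([] : List (H × H)) (x := p) (z := q)
    (R := []) (b := b) (ps := ps)
  have h1 := fun {w ps} y => path_cons_append_split (w := w) [(p, y)] (x := y) (z := q)
    (R := []) (b := b) (ps := ps)
  have h2 := fun {w ps} x y => path_cons_append_split (w := w) [(p, x), (x, y)] (x := y) (z := q)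
    (R := []) (b := b) (ps := ps)
  simp only [List.length_nil, List.length_cons, List.nil_append, List.cons_append, zero_add,
    Nat.reduceAdd] at h0 h1 h2
  rw [handle]
  simp only [h0, h1, h2, path_cons_cross_one, path_cons_cap, path_nil]
  constructor
  · rintro ⟨x, _, rfl, y, _, rfl, z, _, rfl, h, rfl, rfl⟩
    simp only [crossing, Prod.swap_prod_mk, Prod.mk.injEq] at h
    obtain ⟨rfl, rfl⟩ := h
    exact ⟨y, rfl, by simp [crossing, underRight]⟩
  · rintro ⟨x, rfl, rfl⟩
    exact ⟨x, _, rfl, x, _, rfl, p, _, rfl, by simp [crossing], rfl,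
      by simp [crossing, underRight]⟩

/-- The part of the diagram that imposes a relation `l = 1`: the open band of a handle on the
ribbon at position `n` goes around the ribbons to its left as `l` prescribes, and is then attached
again. -/
def gadget {n : ℕ} (l : List (Fin n × Bool)) : List Slice :=
  handle.map (Slice.shift n) ++ (encircle l ++ [⟨.merge, n⟩])

/-- A gadget returns to the labels it started from, has one free label, and imposes the relation `l`
on the elements `(κ i).1⁻¹ * (κ i).2`. -/
theorem path_gadget {n : ℕ} {l : List (Fin n × Bool)} {κ : Fin n → H × H} {p q : H}
    {b : List (H × H)} {ps : List H} :
    Path (gadget l) (List.ofFn κ ++ [(p, q)]) ps b ↔ (∃ x, ps = [x, x, p]) ∧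
      b = List.ofFn κ ++ [(p, q)] ∧
      FreeGroup.lift (fun i => (κ i).1⁻¹ * (κ i).2) (FreeGroup.mk l) = 1 := by
  have h1 := fun {a b ps} => path_shift (w := handle) (a := a) (b := b) (ps := ps) (List.ofFn κ)
  have h3 := fun {x y b ps} => path_append_merge (x := x) (y := y) (R := []) (b := b) (ps := ps)
    (List.ofFn κ)
  rw [List.length_ofFn] at h1 h3
  rw [gadget, path_append]
  simp only [h1, path_handle, path_append]
  constructor
  · rintro ⟨_, _, _, rfl, ⟨_, rfl, x, rfl, rfl⟩, _, _, _, rfl, h2, h4⟩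
    obtain ⟨rfl, rfl⟩ := path_encircle.1 h2
    obtain ⟨rfl, h5, rfl⟩ := h3.1 h4
    have h6 := (mul_eq_left (a := p)).1 h5.symm
    exact ⟨⟨x, rfl⟩, by rw [h6, mul_one], h6⟩
  · rintro ⟨⟨x, rfl⟩, rfl, h⟩
    refine ⟨_, _, [], rfl, ⟨_, rfl, x, rfl, rfl⟩, [], _, [], rfl, path_encircle.2 ⟨rfl, rfl⟩, ?_⟩
    exact h3.2 ⟨rfl, by simp [h], by simp [h]⟩

theorem path_flatMap_gadget {n : ℕ} {ls : List (List (Fin n × Bool))} {κ : Fin n → H × H} {p q : H}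
    {b : List (H × H)} {ps : List H} :
    Path (ls.flatMap gadget) (List.ofFn κ ++ [(p, q)]) ps b ↔
      (∃ xs : List H, xs.length = ls.length ∧ ps = xs.flatMap fun x => [x, x, p]) ∧
      b = List.ofFn κ ++ [(p, q)] ∧
      ∀ l ∈ ls, FreeGroup.lift (fun i => (κ i).1⁻¹ * (κ i).2) (FreeGroup.mk l) = 1 := by
  induction ls generalizing ps with
  | nil =>
    simp [path_nil]
  | cons l ls ih =>
    rw [List.flatMap_cons, path_append]
    simp only [path_gadget]
    constructor
    · rintro ⟨_, _, qs, rfl, ⟨⟨x, rfl⟩, rfl, h⟩, h'⟩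
      obtain ⟨⟨xs, hxs, rfl⟩, rfl, h''⟩ := ih.1 h'
      exact ⟨⟨x :: xs, by simp [hxs], by simp⟩, rfl, List.forall_mem_cons.2 ⟨h, h''⟩⟩
    · rintro ⟨⟨_ | ⟨x, xs⟩, hxs, rfl⟩, rfl, h⟩
      · simp at hxs
      · rw [List.forall_mem_cons] at h
        exact ⟨_, _, _, List.flatMap_cons .., ⟨⟨x, rfl⟩, rfl, h.1⟩,
          ih.2 ⟨⟨xs, by simpa using hxs, rfl⟩, rfl, h.2⟩⟩

omit [Group H] in
/-- The ribbons of a comb, with the last one set apart. -/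
theorem comb_ofFn {n : ℕ} (e : H) (v : Fin (n + 1) → H) :
    comb e (v 0) (List.ofFn fun i : Fin n => v i.succ) =
      List.ofFn (fun i : Fin n => (v i.castSucc, v i.succ)) ++ [(v (Fin.last n), e)] := by
  induction n with
  | zero => rfl
  | succ n ih =>
    rw [List.ofFn_succ, List.ofFn_succ, comb, List.cons_append]
    have := ih fun i => v i.succ
    simp only [Fin.succ_castSucc, Fin.succ_last] at this
    simp only [← Fin.succ_castSucc] at this ⊢
    rw [this]
    rfl

/-- The stack of slices of a presentation with generators `Fin (r + 1)` and relators `ls`: a comb,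
which is made and closed again, with a gadget for each relator in between.  There is at least one
generator, since a comb needs a minimum, which makes two ribbons. -/
def presentationWord (r : ℕ) (ls : List (List (Fin (r + 1) × Bool))) : List Slice :=
  ⟨.cup, 0⟩ :: (splits 1 r ++ (ls.flatMap gadget ++ (merges 1 r ++ [⟨.cap, 0⟩])))

/-- The labellings of the diagram of a presentation: the labels `v` of the comb and one label for
each relator are free, and the elements `(v i)⁻¹ * v (i + 1)` satisfy the relators. -/
theorem path_presentationWord {r : ℕ} {ls : List (List (Fin (r + 1) × Bool))} {ps : List H} :
    Path (presentationWord r ls) [] ps [] ↔ ∃ (v : Fin (r + 2) → H) (xs : List H),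
      xs.length = ls.length ∧
      ps = List.ofFn v ++ xs.flatMap (fun x => [x, x, v (Fin.last _)]) ∧
      ∀ l ∈ ls, FreeGroup.lift (fun i : Fin (r + 1) => (v i.castSucc)⁻¹ * v i.succ)
        (FreeGroup.mk l) = 1 := by
  have hs := fun {z : H × H} {b ps} => path_splits (r := r) (L := [z]) (b := b) (u := z.2)
    (e := z.1) (ps := ps)
  have hm := fun {l} {z : H × H} {b ps} => path_merges (l := l) (L := [z]) (b := b) (u := z.2)
    (e := z.1) (ps := ps)
  simp only [List.length_singleton, List.singleton_append] at hs hm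
  have hv : ∀ v : Fin (r + 2) → H,
      (v 0, v 1) :: comb (v 0) (v 1) (List.ofFn fun i : Fin r => v i.succ.succ) =
      List.ofFn (fun i : Fin (r + 1) => (v i.castSucc, v i.succ)) ++ [(v (Fin.last _), v 0)] := by
    intro v
    have := comb_ofFn (v 0) v
    rwa [List.ofFn_succ, comb] at this
  have hend : ∀ (v : Fin (r + 2) → H) (qs : List H), Path (merges 1 r ++ [⟨.cap, 0⟩])
      (List.ofFn (fun i : Fin (r + 1) => (v i.castSucc, v i.succ)) ++ [(v (Fin.last _), v 0)])
      qs [] ↔ qs = [] := by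
    intro v qs
    have h := fun {b ps} => hm (l := List.ofFn fun i : Fin r => v i.succ.succ) (z := (v 0, v 1))
      (b := b) (ps := ps)
    rw [List.length_ofFn, hv] at h
    rw [path_append]
    simp only [h]
    constructor
    · rintro ⟨_, _, qs, rfl, ⟨rfl, rfl⟩, h⟩
      exact (path_cons_cap.1 h).2.1
    · rintro rfl
      exact ⟨[], _, [], rfl, ⟨rfl, rfl⟩, path_cons_cap.2 ⟨rfl, rfl, rfl⟩⟩
  rw [presentationWord, path_cons_cup]
  constructor
  · rintro ⟨⟨v₀, v₁⟩, _, rfl, h⟩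
    obtain ⟨vs, _, _, rfl, h1, h⟩ := path_append.1 h
    obtain ⟨_, _, _, rfl, h2, h3⟩ := path_append.1 h
    obtain ⟨hl, rfl⟩ := hs.1 h1
    obtain ⟨v, hv'⟩ : ∃ v : Fin (r + 2) → H, List.ofFn v = v₀ :: v₁ :: vs := by
      subst hl
      exact ⟨(v₀ :: v₁ :: vs).get, List.ofFn_get _⟩
    have hv₂ := hv'
    rw [List.ofFn_succ, List.ofFn_succ] at hv'
    simp only [List.cons.injEq] at hv'
    obtain ⟨rfl, rfl, rfl⟩ := hv'
    replace h2 : Path (ls.flatMap gadget)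
      ((v 0, v 1) :: comb (v 0) (v 1) (List.ofFn fun i : Fin r => v i.succ.succ)) _ _ := h2
    rw [hv] at h2
    obtain ⟨⟨xs, hxs, rfl⟩, rfl, h4⟩ := path_flatMap_gadget.1 h2
    obtain rfl := (hend _ _).1 h3
    exact ⟨v, xs, hxs, by rw [hv₂]; simp, h4⟩
  · rintro ⟨v, xs, hxs, rfl, h⟩
    refine ⟨(v 0, v 1), List.ofFn (fun i : Fin r => v i.succ.succ) ++
      xs.flatMap (fun x => [x, x, v (Fin.last _)]), by
        rw [List.ofFn_succ, List.ofFn_succ]; rfl, ?_⟩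
    refine Path.append (hs.2 ⟨by simp, rfl⟩) ?_
    rw [← List.append_nil (xs.flatMap _)]
    refine Path.append ?_ ((hend v []).2 rfl)
    dsimp only
    rw [hv]
    exact path_flatMap_gadget.2 ⟨⟨xs, hxs, rfl⟩, rfl, h⟩

end Construction

/-! ### The group of the diagram of a presentation -/

theorem flatMap_triple_injective {A : Type} {p q : A} {xs ys : List A}
    (h : (xs.flatMap fun x => [x, x, p]) = ys.flatMap fun x => [x, x, q]) : xs = ys := by
  induction xs generalizing ys with
  | nil =>
    rcases ys with _ | ⟨y, ys⟩
    · rfl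
    · simp at h
  | cons x xs ih =>
    rcases ys with _ | ⟨y, ys⟩
    · simp at h
    · simp only [List.flatMap_cons, List.cons_append, List.nil_append, List.cons.injEq] at h
      rw [h.1, ih h.2.2.2]

theorem map_flatMap_triple {A B : Type} (f : A → B) (p : A) (xs : List A) :
    (xs.flatMap fun x => [x, x, p]).map f = (xs.map f).flatMap fun x => [x, x, f p] := by
  simp [List.map_flatMap, List.flatMap_map]

/-- The diagram of a presentation of `G`, together with as many disks as there are generators,
carries a universal labelling in the free product of `G` and a free group, which has one generator
for the outer boundary arc of the comb, one for each relator, and one for each disk. -/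
theorem exists_isUniversal_presentationWord {r m : ℕ} (R : Fin m → FreeGroup (Fin (r + 1))) :
    ∃ (ps : List (Monoid.Coprod (FreeGroup (Option (Fin m ⊕ Fin (r + 1))))
        (PresentedGroup (Set.range R)))) (d : Fin (r + 1) → _),
      IsUniversal (presentationWord r (List.ofFn fun j => (R j).toWord)) (r + 1) ps d := by
  let x : Option (Fin m ⊕ Fin (r + 1)) → Monoid.Coprod (FreeGroup (Option (Fin m ⊕ Fin (r + 1))))
    (PresentedGroup (Set.range R)) := fun o => Monoid.Coprod.inl (FreeGroup.of o)
  let g : Fin (r + 1) → Monoid.Coprod (FreeGroup (Option (Fin m ⊕ Fin (r + 1))))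
    (PresentedGroup (Set.range R)) := fun i => Monoid.Coprod.inr (PresentedGroup.of i)
  -- The comb labels with `(v i)⁻¹ * v (i + 1) = g i` that start at the generator `x none`.
  let v : Fin (r + 2) → _ := fun i => x none * Fin.partialProd g i
  have hg : ∀ i : Fin (r + 1), (v i.castSucc)⁻¹ * v i.succ = g i := by
    intro i
    simp only [v, mul_inv_rev, mul_assoc, inv_mul_cancel_left]
    rw [Fin.partialProd_right_inv]
  have hv : ∀ i : Fin (r + 1), v i.succ = v i.castSucc * g i := by
    intro i
    rw [← hg, mul_inv_cancel_left]
  refine ⟨List.ofFn v ++ (List.ofFn fun j => x (some (.inl j))).flatMap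
    (fun y => [y, y, v (Fin.last _)]), fun i => x (some (.inr i)), ?_, ?_, ?_⟩
  · refine path_presentationWord.2 ⟨v, _, by simp, rfl, ?_⟩
    simp only [hg, List.forall_mem_ofFn_iff, FreeGroup.mk_toWord]
    intro j
    have : FreeGroup.lift g = Monoid.Coprod.inr.comp (PresentedGroup.mk (Set.range R)) :=
      FreeGroup.ext_hom _ _ fun i => by simp [g, PresentedGroup.of]
    rw [this, MonoidHom.comp_apply, PresentedGroup.one_of_mem (Set.mem_range_self j), map_one]
  · intro H _ qs e h
    obtain ⟨v', xs, hxs, rfl, hR⟩ := path_presentationWord.1 h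
    rw [List.length_ofFn] at hxs
    obtain ⟨a, rfl⟩ : ∃ a : Fin m → H, List.ofFn a = xs := by
      subst hxs
      exact ⟨xs.get, List.ofFn_get _⟩
    simp only [List.forall_mem_ofFn_iff, FreeGroup.mk_toWord] at hR
    let f := Monoid.Coprod.lift
      (FreeGroup.lift fun o : Option (Fin m ⊕ Fin (r + 1)) => o.elim (v' 0) (Sum.elim a e))
      (PresentedGroup.toGroup (rels := Set.range R) (by
        rintro _ ⟨j, rfl⟩
        exact hR j))
    have hfx : ∀ o, f (x o) = o.elim (v' 0) (Sum.elim a e) := fun o => by simp [f, x]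
    have hfg : ∀ i, f (g i) = (v' i.castSucc)⁻¹ * v' i.succ := fun i => by simp [f, g]
    have hfv : ∀ i, f (v i) = v' i := by
      intro i
      induction i using Fin.induction with
      | zero => simp [v, hfx]
      | succ i ih => rw [hv, map_mul, ih, hfg, mul_inv_cancel_left]
    refine ⟨f, ?_, fun i => hfx _⟩
    rw [List.map_append, map_flatMap_triple, List.map_ofFn, List.map_ofFn, hfv]
    simp only [Function.comp_def, hfv, hfx, Option.elim_some, Sum.elim_inl]
  · intro H _ f f' h hd
    rw [List.map_append, List.map_append, map_flatMap_triple, map_flatMap_triple] at h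
    obtain ⟨h1, h2⟩ := List.append_inj h (by simp)
    have h3 := flatMap_triple_injective h2
    rw [List.map_ofFn, List.map_ofFn, List.ofFn_inj] at h1 h3
    have hfv : ∀ i, f (v i) = f' (v i) := congrFun h1
    have hfa : ∀ j, f (x (some (.inl j))) = f' (x (some (.inl j))) := congrFun h3
    refine Monoid.Coprod.hom_ext (FreeGroup.ext_hom _ _ ?_) (PresentedGroup.ext fun i => ?_)
    · rintro (_ | j | i)
      · simpa [v] using hfv 0
      · exact hfa j
      · exact hd i
    · change f (g i) = f' (g i)
      rw [← hg, map_mul f, map_mul f', map_inv f, map_inv f', hfv, hfv]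

end SurfaceRibbons

theorem mainTheorem2 {G : Type*} [Group G] :
    (Group.IsFinitelyPresented G →
      ∃ (S : SurfaceRibbons.SurfaceRibbon) (k : ℕ), 0 < k ∧
        S.FundamentalHeapIso (Monoid.Coprod (FreeGroup (Fin k)) G)) ∧
    (∀ (n m : ℕ) (R : Fin m → FreeGroup (Fin n)),
      Nonempty (PresentedGroup (Set.range R) ≃* G) →
      ∃ S : SurfaceRibbons.SurfaceRibbon,
        S.FundamentalHeapIso (Monoid.Coprod (FreeGroup (Fin (n + m + 1))) G)) := by
  have main : ∀ (n m : ℕ) (R : Fin m → FreeGroup (Fin n)),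
      Nonempty (PresentedGroup (Set.range R) ≃* G) →
      ∃ S : SurfaceRibbons.SurfaceRibbon,
        S.FundamentalHeapIso (Monoid.Coprod (FreeGroup (Fin (n + m + 1))) G) := by
    rintro (_ | r) m R ⟨e⟩
    · -- Without generators the group is trivial, and disks alone will do.
      have h : SurfaceRibbons.IsUniversal [] (0 + m + 1)
          ([] : List (Monoid.Coprod (FreeGroup (Fin (0 + m + 1))) (PresentedGroup (Set.range R))))
          (fun i => Monoid.Coprod.inl (FreeGroup.of i)) := by
        refine ⟨⟨rfl, rfl⟩, fun qs d h => ?_, fun f g _ h => ?_⟩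
        · exact ⟨Monoid.Coprod.lift (FreeGroup.lift d) 1, h.1.symm, fun i => by simp⟩
        · exact Monoid.Coprod.hom_ext (FreeGroup.ext_hom _ _ h)
            (PresentedGroup.ext fun i => i.elim0)
      exact ⟨_, h.fundamentalHeapIso (D := ⟨[], rfl, 0 + m + 1⟩)
        (MulEquiv.coprodCongr (MulEquiv.refl _) e)⟩
    · obtain ⟨ps, d, h⟩ := SurfaceRibbons.exists_isUniversal_presentationWord R
      have ε : Option (Fin m ⊕ Fin (r + 1)) ≃ Fin (r + 1 + m + 1) :=
        Fintype.equivFinOfCardEq (by simp; omega)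
      exact ⟨_, h.fundamentalHeapIso (D := ⟨_, h.path.fits, r + 1⟩)
        (MulEquiv.coprodCongr (FreeGroup.freeGroupCongr ε) e)⟩
  refine ⟨fun hG => ?_, main⟩
  obtain ⟨n, s, hs, ⟨e⟩⟩ := Group.IsFinitelyPresented.exists_mulEquiv_presentedGroup (G := G)
  obtain ⟨m, R, -, rfl⟩ := hs.fin_param
  obtain ⟨S, hS⟩ := main n m R ⟨e.symm⟩
  exact ⟨S, n + m + 1, Nat.succ_pos _, hS⟩
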